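/- Let $P_n=(n,n^2)\in\mathbb{R}^2$ for $n\in\mathbb{Z}$, let $Q^+$ be the convex hull of $\{P_n : n\in\mathbb{Z}\}$ and let $Q^-=-Q^+$. Let $S_1$ be the translation surface obtained from the disjoint union of $Q^+$ and $Q^-$ by identifying, for every $n\in\mathbb{Z}$, the edge $\overline{P_nP_{n+1}}$ of $Q^+$ with the edge $\overline{(-P_{n+1})(-P_n)}$ of $Q^-$ by the translation $p\mapsto p-(P_n+P_{n+1})$. Its singularities are the images of the vertices of the two polygons, and its area measure is Lebesgue measure on the two polygons. **Theorem (Recurrence).** The straight-line (geodesic) flow on $S_1$ in every direction of irrational slope is recurrent with respect to area. That is, let $v=(v_1,v_2)\in\mathbb{R}^2$ with $v_1\neq 0$ and $v_2/v_1$ irrational, and let $A\subseteq S_1$ be measurable. Then for almost every $x\in A$ the straight-line trajectory $\gamma:\mathbb{R}\to S_1$ with velocity $v$ and $\gamma(0)=x$ is defined for all times without meeting a singularity, and $\gamma(t)\in A$ for arbitrarily large positive $t$ and for arbitrarily large negative $t$. -/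

import Mathlib

open MeasureTheory Filter

namespace ParabolaSurface

/-- The integer points `(n, n²)` of the parabola `y = x²`. -/
def vertex (n : ℤ) : ℝ × ℝ := ((n : ℝ), (n : ℝ) ^ 2)

/-- The infinite polygon with vertices `(n, n²)`, `n ∈ ℤ`. -/
def upperPolygon : Set (ℝ × ℝ) := convexHull ℝ (Set.range vertex)

/-- The two polygons: `true` is the upper one, `false` is its image under the rotation by `π`
about the origin, that is, the convex hull of the points `(n, -n²)`. -/
def polygon (b : Bool) : Set (ℝ × ℝ) :=
  if b then upperPolygon else {p | -p ∈ upperPolygon}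

/-- The `n`-th edge of the upper polygon, joining `(n, n²)` to `(n + 1, (n + 1)²)`. -/
def edge (n : ℤ) : Set (ℝ × ℝ) := segment ℝ (vertex n) (vertex (n + 1))

/-- The disjoint union of the two polygons. -/
abbrev Pieces : Type := Σ b : Bool, polygon b

/-- Every edge `e` of the upper polygon is identified with its image `-e` in the lower polygon by
the translation that carries `e` to `-e`. For the `n`-th edge this is the translation by
`-(vertex n + vertex (n + 1))`, which sends `vertex n` to `-vertex (n + 1)` and `vertex (n + 1)`
to `-vertex n`. -/
def Glue (x y : Pieces) : Prop :=
  x.1 = true ∧ y.1 = false ∧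
    ∃ n : ℤ, (x.2 : ℝ × ℝ) ∈ edge n ∧
      (y.2 : ℝ × ℝ) = (x.2 : ℝ × ℝ) - (vertex n + vertex (n + 1))

/-- The translation surface `S₁`: the quotient of the two polygons by the equivalence relation
that the edge identifications generate. -/
def S₁ : Type := Quot Glue

/-- The point of the surface that is represented by a point of one of the polygons. -/
def proj (b : Bool) (p : polygon b) : S₁ := Quot.mk Glue ⟨b, p⟩

/-- A subset of `S₁` is measurable when its preimages in the two polygons are. -/
instance : MeasurableSpace S₁ := inferInstanceAs (MeasurableSpace (Quot Glue))

/-- The area measure of `S₁`: Lebesgue measure on each of the polygons. -/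
noncomputable def area : Measure S₁ :=
  Measure.sum fun b : Bool =>
    Measure.map (proj b) (Measure.comap (Subtype.val : polygon b → ℝ × ℝ) volume)

theorem nullMeasurableSet_polygon (b : Bool) :
    NullMeasurableSet (polygon b) (volume : Measure (ℝ × ℝ)) := by
  apply Convex.nullMeasurableSet
  cases b
  · have h : polygon false = (-LinearMap.id : (ℝ × ℝ) →ₗ[ℝ] ℝ × ℝ) ⁻¹' upperPolygon := by
      ext p
      simp [polygon]
    rw [h]
    exact (convex_convexHull ℝ _).linear_preimage _
  · simpa [polygon, upperPolygon] using convex_convexHull ℝ (Set.range vertex)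

theorem measurable_proj (b : Bool) : Measurable (proj b) :=
  measurable_quot_mk.comp fun _ hs => MeasurableSpace.measurableSet_iInf.1 hs b

/-- The area of a measurable set is the sum of the Lebesgue measures of its parts in the two
polygons. -/
theorem area_apply {A : Set S₁} (hA : MeasurableSet A) :
    area A = ∑ b : Bool, volume ((Subtype.val : polygon b → ℝ × ℝ) '' (proj b ⁻¹' A)) := by
  rw [area, Measure.sum_apply _ hA, tsum_fintype]
  refine Finset.sum_congr rfl fun b _ => ?_
  rw [Measure.map_apply (measurable_proj b) hA]
  refine Measure.comap_apply₀ _ _ Subtype.val_injective (fun s hs => ?_)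
    (measurable_proj b hA).nullMeasurableSet
  exact MeasureTheory.Measure.MeasurableSet.nullMeasurableSet_subtype_coe (nullMeasurableSet_polygon b) hs

/-- The cone singularities of `S₁`: the images of the vertices of the polygons. -/
def singularities : Set S₁ :=
  {x | ∃ (b : Bool) (p : polygon b), x = proj b p ∧
    ∃ n : ℤ, (p : ℝ × ℝ) = if b then vertex n else -vertex n}

/-- `γ` is a bi-infinite straight-line trajectory on `S₁` with velocity `v`: it avoids the
singularities, and just before and just after every time `t` it moves in one of the polygons along
a straight segment with velocity `v`. (The two polygons are different when `γ` crosses an edge at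
time `t`.) -/
def IsTrajectory (v : ℝ × ℝ) (γ : ℝ → S₁) : Prop :=
  ∀ t : ℝ, γ t ∉ singularities ∧ ∃ ε > (0 : ℝ),
    (∃ (b : Bool) (p : ℝ × ℝ), ∀ s ∈ Set.Icc (t - ε) t,
      ∃ h : p + (s - t) • v ∈ polygon b, γ s = proj b ⟨p + (s - t) • v, h⟩) ∧
    (∃ (b : Bool) (p : ℝ × ℝ), ∀ s ∈ Set.Icc t (t + ε),
      ∃ h : p + (s - t) • v ∈ polygon b, γ s = proj b ⟨p + (s - t) • v, h⟩)

/-- The straight-line flow with velocity `v` on `S₁` is recurrent (with respect to area): for every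
measurable set `A`, the trajectory of almost every point of `A` is defined for all times and is in
`A` at arbitrarily large positive times and at arbitrarily large negative times. -/
def IsRecurrent (v : ℝ × ℝ) : Prop :=
  ∀ A : Set S₁, MeasurableSet A → ∀ᵐ x ∂area, x ∈ A →
    ∃ γ : ℝ → S₁, IsTrajectory v γ ∧ γ 0 = x ∧
      (∃ᶠ t in atTop, γ t ∈ A) ∧ (∃ᶠ t in atBot, γ t ∈ A)

end ParabolaSurface

open scoped ENNReal

/-! The area is infinite, so recurrence is not automatic. It follows from sets of finite measure
through whose boundary arbitrarily little of the flow passes.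

The rotation by π and the affine reflections exchanging the vertices `n` and `m - n` act on the
surface and send the slope `α` to `2m - α` (up to the sign of the velocity). Hence slopes in `(0,
1)` suffice. For these, a trajectory is a chain of chords of the two polygons. The shear `(X, Y) ↦
(X - Y, Y)` makes the velocity `(1 - α, α)` and the edges diagonals of rectangles of integer sides
that are glued to an infinite staircase. In a rectangle of width `w` and height `h`, the form `yX -
xY` is constant along the direction `(x, y)` and ranges from `-hx` to `wy`. It is the coordinate on
the transversal, and `step` is the resulting passage from rectangle to rectangle; `b = true`
transposes the staircase.

A wandering set inside a set of finite measure has to come in through the boundary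
(`measure_inter_le_of_wandering`), so almost invariant sets of finite measure that exhaust the space
make `step` conservative. If the first `N + 1` rectangles form complete cylinders in one direction,
orbits enter them through a single side, with flux at most `(N + 1) x`. All nondegenerate cylinders
are half as wide as long, so twists and reflections carry almost invariant sets for `(x, y)` to such
sets for `(x, y + 2x)` and `(x, 2x - y)`. Running the Euclidean algorithm with even quotients on
`(y, x)`, with remainders `r`, yields sets of flux at most `(N + 1 + k) * r (k + 1)`. This is
arbitrarily small for suitable `k`: the differences of the remainders are decreasing and summable,
and infinitely often they dominate the next remainder (`IsEvenEuclid.exists_mul_lt`).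

Finally, for each fixed time offset along the chords, conservativity brings almost every chord back
to `A` at this same offset, and Fubini turns this into a statement about almost every point. The
durations of the chords have infinite sum, again by conservativity, so the trajectories are defined
for all times. -/

namespace ParabolaSurface

/-! ### Conservativity from almost invariant sets of finite measure -/

section Abstract

variable {X X' : Type*} [MeasurableSpace X] [MeasurableSpace X'] {μ : Measure X} {μ' : Measure X'}
  {T : X → X} {T' : X' → X'}

/-- A measurable set that never returns to itself leaves every set of finite measure, through the
part of that set where orbits cross its boundary. -/
theorem measure_inter_le_of_wandering (hT : MeasurePreserving T μ μ) {W K : Set X}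
    (hW : MeasurableSet W) (hK : MeasurableSet K) (hfin : μ K ≠ ∞)
    (hwand : ∀ x ∈ W, ∀ m : ℕ, m ≠ 0 → T^[m] x ∉ W) :
    μ (W ∩ K) ≤ μ (T ⁻¹' K \ K) := by
  -- `B n` consists of the points whose orbit stays in `K` up to time `n` and is in `W` at time `n`.
  let B : ℕ → Set X := fun n => Nat.rec (W ∩ K) (fun _ s => K ∩ T ⁻¹' s) n
  have hB0 : B 0 = W ∩ K := rfl
  have hBs : ∀ n, B (n + 1) = K ∩ T ⁻¹' B n := fun _ => rfl
  have hBm : ∀ n, MeasurableSet (B n) := by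
    intro n
    induction n with
    | zero => exact hW.inter hK
    | succ n ih => exact hK.inter (hT.measurable ih)
  have hBK : ∀ n, B n ⊆ K := by
    intro n
    cases n with
    | zero => exact Set.inter_subset_right
    | succ n => exact Set.inter_subset_left
  have hBW : ∀ n, ∀ x ∈ B n, T^[n] x ∈ W := by
    intro n
    induction n with
    | zero => exact fun x hx => hx.1
    | succ n ih => exact fun x hx => ih _ hx.2
  have hdisj : ∀ C : ℕ → Set X, (∀ n, ∀ x ∈ C n, T^[n] x ∈ W) → Pairwise (Function.onFun Disjoint C) := by
    intro C hC
    have key : ∀ i j, i < j → Disjoint (C i) (C j) := by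
      intro i j hij
      rw [Set.disjoint_left]
      intro x hi hj
      have h1 := hwand _ (hC i x hi) (j - i) (by omega)
      rw [← Function.iterate_add_apply, Nat.sub_add_cancel hij.le] at h1
      exact h1 (hC j x hj)
    intro i j hij
    rcases lt_or_gt_of_ne hij with h | h
    · exact key i j h
    · exact (key j i h).symm
  -- The part of `T ⁻¹' B n` outside `K` enters `K` at the next step. These parts are disjoint
  -- because `W` never returns, so their total measure is bounded by the boundary flux. What is
  -- left, `μ (B n)`, tends to zero because the sets `B n` are disjoint inside `K`.
  let E : ℕ → Set X := fun n => T ⁻¹' B n \ K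
  have hEm : ∀ n, MeasurableSet (E n) := fun n => (hT.measurable (hBm n)).diff hK
  have hEdisj : Pairwise (Function.onFun Disjoint E) := by
    have h : ∀ i j, i < j → Disjoint (E i) (E j) := by
      intro i j hij
      rw [Set.disjoint_left]
      intro x hi hj
      exact Set.disjoint_left.1 (hdisj B hBW hij.ne) hi.1 hj.1
    intro i j hij
    rcases lt_or_gt_of_ne hij with h' | h'
    · exact h i j h'
    · exact (h j i h').symm
  have hstep : ∀ n, μ (B n) = μ (B (n + 1)) + μ (E n) := by
    intro n
    rw [← hT.measure_preimage (hBm n).nullMeasurableSet, hBs,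
      Set.inter_comm, measure_inter_add_sdiff _ hK]
  have hsum : ∀ n, μ (B 0) = μ (B n) + ∑ i ∈ Finset.range n, μ (E i) := by
    intro n
    induction n with
    | zero => simp
    | succ n ih => rw [ih, hstep n, Finset.sum_range_succ]; ring
  have hE : ∀ n, ∑ i ∈ Finset.range n, μ (E i) ≤ μ (T ⁻¹' K \ K) := by
    intro n
    rw [← measure_biUnion_finset (fun i _ j _ hij => hEdisj hij) (fun i _ => hEm i)]
    refine measure_mono (Set.iUnion₂_subset fun i _ => ?_)
    exact Set.sdiff_subset_sdiff_left (Set.preimage_mono (hBK i))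
  have hBt : ∑' n, μ (B n) ≠ ∞ := by
    rw [← measure_iUnion (hdisj B hBW) hBm]
    exact ne_top_of_le_ne_top hfin (measure_mono (Set.iUnion_subset hBK))
  have hlim := ENNReal.tendsto_atTop_zero_of_tsum_ne_top hBt
  have hlim' : Tendsto (fun n => μ (B n) + μ (T ⁻¹' K \ K)) atTop (nhds (0 + μ (T ⁻¹' K \ K))) :=
    hlim.add tendsto_const_nhds
  rw [zero_add] at hlim'
  refine ge_of_tendsto' hlim' fun n => ?_
  rw [← hB0, hsum n]
  gcongr
  exact hE n

/-- A measure preserving map is conservative when the sets of an exhaustion are contained in sets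
of finite measure that are almost invariant. -/
theorem conservative_of_almost_invariant (hT : MeasurePreserving T μ μ) (B : ℕ → Set X)
    (hB : ∀ᵐ x ∂μ, ∃ n, x ∈ B n)
    (h : ∀ n, ∀ ε : ℝ≥0∞, ε ≠ 0 → ∃ K, MeasurableSet K ∧ (∀ᵐ x ∂μ, x ∈ B n → x ∈ K) ∧ μ K ≠ ∞ ∧
      μ (T ⁻¹' K \ K) ≤ ε) :
    Conservative T μ := by
  refine ⟨hT.quasiMeasurePreserving, fun W hW hpos => ?_⟩
  by_contra hcon
  push Not at hcon
  apply hpos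
  have hz : ∀ n, μ (W ∩ B n) = 0 := by
    intro n
    by_contra hne
    -- With half the measure of `W ∩ B n` as the allowed flux, this measure would be at most its own
    -- half, though it is finite and nonzero.
    obtain ⟨K, hK, hsub, hfin, hle⟩ := h n (μ (W ∩ B n) / 2) (by simpa using hne)
    have h1 := measure_inter_le_of_wandering hT hW hK hfin hcon
    have h2 : μ (W ∩ B n) ≤ μ (W ∩ K) := by
      refine measure_mono_ae ?_
      filter_upwards [hsub] with x hx hxW using ⟨hxW.1, hx hxW.2⟩
    have h3 : μ (W ∩ B n) ≠ ∞ :=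
      ne_top_of_le_ne_top hfin (h2.trans (measure_mono Set.inter_subset_right))
    exact absurd (h2.trans (h1.trans hle)) (not_le.2 (ENNReal.half_lt_self hne h3))
  have h0 : μ (⋃ n, W ∩ B n) = 0 := measure_iUnion_null hz
  refine measure_mono_null_ae ?_ h0
  filter_upwards [hB] with x hx hxW
  obtain ⟨n, hn⟩ := hx
  exact Set.mem_iUnion.2 ⟨n, hxW, hn⟩

/-- `y` is the point where the orbit of `x` first returns to `A`, and the return takes at most three
steps. -/
def ReturnsTo (T : X → X) (A : Set X) (x y : X) : Prop :=
  (y ∈ A ∧ y = T x) ∨ (T x ∉ A ∧ y ∈ A ∧ y = T (T x)) ∨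
    (T x ∉ A ∧ T (T x) ∉ A ∧ y ∈ A ∧ y = T (T (T x)))

/-- The points outside `K` in `A` whose first return to `A` is in `K` are at most as many as
the points where orbits enter `K`. -/
theorem measure_returnsTo_le (hT : MeasurePreserving T μ μ) {A K : Set X} (hA : MeasurableSet A)
    (hK : MeasurableSet K) :
    ∃ E, MeasurableSet E ∧ (∀ x ∈ A, x ∉ K → ∀ y ∈ K, ReturnsTo T A x y → x ∈ E) ∧
      μ (A ∩ E) ≤ μ (T ⁻¹' K \ K) := by
  -- `D` is where orbits enter `K`. An entry outside `A` is traced back, one step at a time, to the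
  -- last visit to `A`. Each pullback preserves measure and the part already in `A` is split off
  -- before the next one, so the total does not exceed `μ D`.
  set D := T ⁻¹' K \ K with hD
  have hDm : MeasurableSet D := (hT.measurable hK).diff hK
  set D₁ := T ⁻¹' (D \ A) with hD₁
  have hD₁m : MeasurableSet D₁ := hT.measurable (hDm.diff hA)
  set D₂ := T ⁻¹' (D₁ \ A) with hD₂
  have hD₂m : MeasurableSet D₂ := hT.measurable (hD₁m.diff hA)
  refine ⟨D ∪ D₁ ∪ D₂, (hDm.union hD₁m).union hD₂m, ?_, ?_⟩
  · intro x hxA hxK y hyK hxy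
    simp only [hD, hD₁, hD₂, Set.mem_union, Set.mem_preimage, Set.mem_sdiff]
    rcases hxy with ⟨-, rfl⟩ | ⟨h1, -, rfl⟩ | ⟨h1, h2, -, rfl⟩ <;> tauto
  · have e1 : μ (D ∩ A) + μ D₁ = μ D := by
      rw [hD₁, hT.measure_preimage (hDm.diff hA).nullMeasurableSet, measure_inter_add_sdiff _ hA]
    have e2 : μ (D₁ ∩ A) + μ D₂ = μ D₁ := by
      rw [hD₂, hT.measure_preimage (hD₁m.diff hA).nullMeasurableSet, measure_inter_add_sdiff _ hA]
    calc μ (A ∩ (D ∪ D₁ ∪ D₂)) ≤ μ (D ∩ A ∪ D₁ ∩ A ∪ D₂) := by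
          refine measure_mono fun x hx => ?_
          simp only [Set.mem_inter_iff, Set.mem_union] at hx ⊢
          tauto
      _ ≤ μ (D ∩ A) + μ (D₁ ∩ A) + μ D₂ :=
          (measure_union_le _ _).trans (add_le_add_left (measure_union_le _ _) _)
      _ = μ D := by rw [add_assoc, e2, e1]

/-- Almost invariant sets are carried from one system to another one along sections with conjugate
return maps. -/
theorem exists_almost_invariant_transfer (hT : MeasurePreserving T μ μ)
    (hT' : MeasurePreserving T' μ' μ') {A K : Set X} {A' : Set X'} (hA : MeasurableSet A)
    (hA' : MeasurableSet A') (hK : MeasurableSet K) {φ : X' → X} (hφ : Measurable φ)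
    (hφA : ∀ B, MeasurableSet B → μ' (A' ∩ φ ⁻¹' B) ≤ μ (A ∩ B)) (hfin : μ K ≠ ∞)
    (hhit : ∀ᵐ x ∂μ', x ∈ A' ∨ T' x ∈ A' ∨ T' (T' x) ∈ A')
    (hret : ∀ᵐ x ∂μ', x ∈ A' → φ x ∈ A ∧
      ∃ y, ReturnsTo T' A' x y ∧ ReturnsTo T A (φ x) (φ y)) :
    ∃ K', MeasurableSet K' ∧ μ' K' ≠ ∞ ∧ μ' (T' ⁻¹' K' \ K') ≤ μ (T ⁻¹' K \ K) ∧
      ∀ x y, (y = x ∨ x ∉ A' ∧ y = T' x ∨ x ∉ A' ∧ T' x ∉ A' ∧ y = T' (T' x)) → y ∈ A' → φ y ∈ K →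
        x ∈ K' := by
  -- `P₀`, `P₁`, `P₂` are the points that first meet `A'` after 0, 1, 2 steps, at a point that `φ`
  -- sends into `K`. Their union is the transferred set.
  set P₀ := A' ∩ φ ⁻¹' K with hP₀
  have hP₀m : MeasurableSet P₀ := hA'.inter (hφ hK)
  set P₁ := T' ⁻¹' P₀ \ A' with hP₁
  have hP₁m : MeasurableSet P₁ := (hT'.measurable hP₀m).diff hA'
  set P₂ := T' ⁻¹' P₁ \ A' with hP₂
  have hP₂m : MeasurableSet P₂ := (hT'.measurable hP₁m).diff hA'
  obtain ⟨E, hE, hEmem, hEle⟩ := measure_returnsTo_le hT hA hK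
  have f0 : μ' P₀ ≠ ∞ :=
    ne_top_of_le_ne_top hfin ((hφA K hK).trans (measure_mono Set.inter_subset_right))
  have f1 : μ' P₁ ≠ ∞ := by
    refine ne_top_of_le_ne_top f0 ((measure_mono Set.sdiff_subset).trans ?_)
    rw [hT'.measure_preimage hP₀m.nullMeasurableSet]
  have f2 : μ' P₂ ≠ ∞ := by
    refine ne_top_of_le_ne_top f1 ((measure_mono Set.sdiff_subset).trans ?_)
    rw [hT'.measure_preimage hP₁m.nullMeasurableSet]
  refine ⟨P₀ ∪ P₁ ∪ P₂, (hP₀m.union hP₁m).union hP₂m, ?_, ?_, ?_⟩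
  · refine ne_top_of_le_ne_top ?_ ((measure_union_le _ _).trans
      (add_le_add_left (measure_union_le _ _) _))
    simp [f0, f1, f2]
  · calc μ' (T' ⁻¹' (P₀ ∪ P₁ ∪ P₂) \ (P₀ ∪ P₁ ∪ P₂)) ≤ μ' (A' ∩ φ ⁻¹' E) := by
          refine measure_mono_ae ?_
          filter_upwards [hhit, hret] with x hx1 hx2 hx3
          -- Outside `A'` a point and its image have the same first hit of `A'`, which by `hhit`
          -- comes within two steps. So orbits can enter the new set only from `A'`, where the
          -- conjugacy of the return maps applies.
          have hxA : x ∈ A' := by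
            by_contra hxA
            change x ∈ T' ⁻¹' (P₀ ∪ P₁ ∪ P₂) \ (P₀ ∪ P₁ ∪ P₂) at hx3
            simp only [hP₀, hP₁, hP₂, Set.mem_union, Set.mem_preimage, Set.mem_sdiff,
              Set.mem_inter_iff] at hx3
            tauto
          obtain ⟨hφx, y, hy1, hy2⟩ := hx2 hxA
          change x ∈ T' ⁻¹' (P₀ ∪ P₁ ∪ P₂) \ (P₀ ∪ P₁ ∪ P₂) at hx3
          simp only [hP₀, hP₁, hP₂, Set.mem_union, Set.mem_preimage, Set.mem_sdiff,
              Set.mem_inter_iff] at hx3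
          refine ⟨hxA, hEmem _ hφx (by tauto) (φ y) ?_ hy2⟩
          rcases hy1 with ⟨h0, rfl⟩ | ⟨h1, h0, rfl⟩ | ⟨h1, h2, h0, rfl⟩ <;> tauto
      _ ≤ μ (A ∩ E) := hφA E hE
      _ ≤ _ := hEle
  · intro x y h hy hyK
    simp only [hP₀, hP₁, hP₂, Set.mem_union, Set.mem_preimage, Set.mem_sdiff, Set.mem_inter_iff]
    rcases h with rfl | ⟨h1, rfl⟩ | ⟨h1, h2, rfl⟩ <;> tauto

end Abstract

/-! ### The staircase and its transversal map -/

/-- The two pairings of the rectangles of the staircase: `nb false` is the horizontal neighbor and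
`nb true` the vertical one. -/
def nb (b : Bool) (j : ℕ) : ℕ :=
  if b then (if j = 0 then 0 else if j % 2 = 1 then j + 1 else j - 1)
  else (if j % 2 = 0 then j + 1 else j - 1)

/-- The side lengths of the rectangles of the staircase: `len false` is the height and `len true`
the width. -/
def len (b : Bool) (j : ℕ) : ℝ :=
  if b then (if j % 2 = 0 then j else j + 1) else (if j % 2 = 0 then j + 1 else j)

theorem nb_nb (b : Bool) (j : ℕ) : nb b (nb b j) = j := by
  unfold nb; cases b <;> simp <;> grind

theorem nb_le (b : Bool) (j : ℕ) : nb b j ≤ j + 1 := by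
  unfold nb; cases b <;> simp <;> grind

theorem nb_true_le {j m : ℕ} (h : j ≤ 2 * m) : nb true j ≤ 2 * m := by
  unfold nb; simp; grind

theorem nb_false_le {j m : ℕ} (h : j ≤ 2 * m + 1) : nb false j ≤ 2 * m + 1 := by
  unfold nb; simp; grind

theorem len_nb (b : Bool) (j : ℕ) : len b (nb b j) = len b j := by
  unfold nb len
  rcases Nat.even_or_odd' j with ⟨k, rfl | rfl⟩ <;> cases b
  · have : (2 * k + 1) % 2 = 1 := by omega
    simp [this]
  · rcases k with _ | k
    · simp
    · have h1 : (2 * (k + 1)) % 2 = 0 := by omega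
      have h2 : (2 * (k + 1) - 1) = 2 * k + 1 := by omega
      have h3 : (2 * k + 1) % 2 = 1 := by omega
      simp [h2, h3]; ring
  · have : (2 * k + 1) % 2 = 1 := by omega
    simp [this]
  · have h1 : (2 * k + 1) % 2 = 1 := by omega
    have h2 : (2 * k + 1 + 1) % 2 = 0 := by omega
    simp [h1, h2]

theorem len_nonneg (b : Bool) (j : ℕ) : 0 ≤ len b j := by
  unfold len; split_ifs <;> positivity

theorem len_le (b : Bool) (j : ℕ) : len b j ≤ j + 1 := by
  unfold len; split_ifs <;> linarith

/-- A cylinder is half as wide as it is long. -/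
theorem len_add_len_nb (b : Bool) (j : ℕ) :
    len b j + len b (nb (!b) j) = 2 * len (!b) j ∨ len (!b) j = 0 := by
  unfold nb len
  rcases Nat.even_or_odd' j with ⟨k, rfl | rfl⟩ <;> cases b
  · rcases k with _ | k
    · simp
    · have h1 : (2 * (k + 1)) % 2 = 0 := by omega
      have h2 : (2 * (k + 1) - 1) = 2 * k + 1 := by omega
      have h3 : (2 * k + 1) % 2 = 1 := by omega
      left; simp [h2, h3]; ring
  · have : (2 * k + 1) % 2 = 1 := by omega
    left; simp [this]; ring
  · have h1 : (2 * k + 1) % 2 = 1 := by omega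
    have h2 : (2 * k + 1 + 1) % 2 = 0 := by omega
    left; simp [h1, h2]; ring
  · have : (2 * k + 1) % 2 = 1 := by omega
    left; simp [this]; ring

/-- The transversal of the staircase for the direction `(x, y)`: one interval for each rectangle. -/
def strip (b : Bool) (x y : ℝ) : Set (ℕ × ℝ) :=
  {z | -(len b z.1 * x) < z.2 ∧ z.2 ≤ len (!b) z.1 * y}

/-- The passage through one rectangle in direction `(x, y)`. -/
noncomputable def step (b : Bool) (x y : ℝ) (z : ℕ × ℝ) : ℕ × ℝ :=
  if len (!b) z.1 * y - len b z.1 * x < z.2 then (nb b z.1, z.2 - len (!b) z.1 * y)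
  else (nb (!b) z.1, z.2 + len b z.1 * x)

/-- The transverse measure of the flow in direction `(x, y)`. -/
noncomputable def flux (b : Bool) (x y : ℝ) : Measure (ℕ × ℝ) :=
  (Measure.count.prod volume).restrict (strip b x y)

theorem measurable_len (b : Bool) : Measurable (fun z : ℕ × ℝ => len b z.1) :=
  (measurable_of_countable (len b)).comp measurable_fst

theorem measurable_nb (b : Bool) : Measurable (fun z : ℕ × ℝ => nb b z.1) :=
  (measurable_of_countable (nb b)).comp measurable_fst

theorem measurableSet_strip (b : Bool) (x y : ℝ) : MeasurableSet (strip b x y) :=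
  (measurableSet_lt ((measurable_len b).mul_const x).neg measurable_snd).inter
    (measurableSet_le measurable_snd ((measurable_len (!b)).mul_const y))

theorem measurable_step (b : Bool) (x y : ℝ) : Measurable (step b x y) := by
  refine Measurable.ite (measurableSet_lt ?_ measurable_snd) ?_ ?_
  · exact ((measurable_len (!b)).mul_const y).sub ((measurable_len b).mul_const x)
  · exact (measurable_nb b).prodMk (measurable_snd.sub ((measurable_len (!b)).mul_const y))
  · exact (measurable_nb (!b)).prodMk (measurable_snd.add ((measurable_len b).mul_const x))

theorem ae_mem_strip (b : Bool) (x y : ℝ) : ∀ᵐ z ∂flux b x y, z ∈ strip b x y :=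
  ae_restrict_mem (measurableSet_strip b x y)

theorem flux_apply (b : Bool) (x y : ℝ) {B : Set (ℕ × ℝ)} (hB : MeasurableSet B) :
    flux b x y B =
      ∑' j, volume {c : ℝ | (j, c) ∈ B ∧ -(len b j * x) < c ∧ c ≤ len (!b) j * y} := by
  rw [flux, Measure.restrict_apply hB, Measure.prod_apply (hB.inter (measurableSet_strip b x y)),
    lintegral_count]
  rfl

/-- Sets that meet every interval of the transversal in a countable set are null. -/
theorem flux_eq_zero_of_countable (b : Bool) (x y : ℝ) {B : Set (ℕ × ℝ)} (hB : B.Countable) :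
    flux b x y B = 0 := by
  rw [flux_apply b x y hB.measurableSet, ENNReal.tsum_eq_zero]
  intro j
  refine Set.Countable.measure_zero ?_ _
  exact (hB.preimage (f := fun c : ℝ => (j, c)) (Prod.mk_right_injective j)).mono fun c hc => hc.1

theorem ae_ne_flux (b : Bool) (x y : ℝ) (f : ℕ → ℝ) : ∀ᵐ z ∂flux b x y, z.2 ≠ f z.1 := by
  have h := flux_eq_zero_of_countable b x y (B := Set.range fun j => (j, f j))
    (Set.countable_range _)
  refine measure_mono_null (fun z hz => ?_) h
  simp only [Set.mem_compl_iff, Set.mem_ofPred_eq, not_not] at hz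
  exact ⟨z.1, Prod.ext rfl hz.symm⟩

/-- Each interval splits at the exit corner into two pieces. They are translated onto the
nonpositive part of the transversal of one neighbor and the positive part of that of the other.
Paired rectangles have equal sides (`len_nb`) and the pairings are involutions, so summing over all
rectangles reproduces the measure. -/
theorem measurePreserving_step (b : Bool) {x y : ℝ} (hx : 0 < x) (hy : 0 < y) :
    MeasurePreserving (step b x y) (flux b x y) (flux b x y) := by
  refine ⟨measurable_step b x y, ?_⟩
  ext B hB
  rw [Measure.map_apply (measurable_step b x y) hB, flux_apply b x y hB,
    flux_apply b x y (measurable_step b x y hB)]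
  have hsec : ∀ j, MeasurableSet {c : ℝ | (j, c) ∈ B} := fun j => measurable_prodMk_left hB
  have e1 : ∀ j, volume {c : ℝ | (j, c) ∈ step b x y ⁻¹' B ∧ -(len b j * x) < c ∧
        c ≤ len (!b) j * y} =
      volume {c : ℝ | (nb b j, c) ∈ B ∧ -(len b (nb b j) * x) < c ∧ c ≤ 0} +
      volume {c : ℝ | (nb (!b) j, c) ∈ B ∧ 0 < c ∧ c ≤ len (!b) (nb (!b) j) * y} := by
    intro j
    have hl := mul_nonneg (len_nonneg b j) hx.le
    have hw := mul_nonneg (len_nonneg (!b) j) hy.le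
    rw [len_nb, len_nb,
      ← measure_preimage_add_right volume (-(len (!b) j * y))
        {c : ℝ | (nb b j, c) ∈ B ∧ -(len b j * x) < c ∧ c ≤ 0},
      ← measure_preimage_add_right volume (len b j * x)
        {c : ℝ | (nb (!b) j, c) ∈ B ∧ 0 < c ∧ c ≤ len (!b) j * y}]
    rw [← measure_union]
    · congr 1
      ext c
      simp only [Set.mem_ofPred_eq, Set.mem_preimage, Set.mem_union, step, sub_eq_add_neg]
      split_ifs with h
      · constructor
        · rintro ⟨h1, h2, h3⟩
          exact Or.inl ⟨h1, by linarith, by linarith⟩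
        · rintro (⟨h1, h2, h3⟩ | ⟨h1, h2, h3⟩)
          · exact ⟨h1, by linarith, by linarith⟩
          · linarith
      · constructor
        · rintro ⟨h1, h2, h3⟩
          exact Or.inr ⟨h1, by linarith, by linarith⟩
        · rintro (⟨h1, h2, h3⟩ | ⟨h1, h2, h3⟩)
          · linarith
          · exact ⟨h1, by linarith, by linarith⟩
    · rw [Set.disjoint_left]
      rintro c ⟨-, h1, h2⟩ ⟨-, h3, h4⟩
      simp only at h1 h2 h3 h4
      linarith
    · refine (measurable_add_const _) ?_
      exact (hsec _).inter measurableSet_Ioc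
  have e2 : ∀ j, volume {c : ℝ | (j, c) ∈ B ∧ -(len b j * x) < c ∧ c ≤ len (!b) j * y} =
      volume {c : ℝ | (j, c) ∈ B ∧ -(len b j * x) < c ∧ c ≤ 0} +
      volume {c : ℝ | (j, c) ∈ B ∧ 0 < c ∧ c ≤ len (!b) j * y} := by
    intro j
    have hl := mul_nonneg (len_nonneg b j) hx.le
    have hw := mul_nonneg (len_nonneg (!b) j) hy.le
    rw [← measure_union]
    · congr 1
      ext c
      simp only [Set.mem_ofPred_eq, Set.mem_union]
      constructor
      · rintro ⟨h1, h2, h3⟩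
        rcases le_or_gt c 0 with h | h
        · exact Or.inl ⟨h1, h2, h⟩
        · exact Or.inr ⟨h1, h, h3⟩
      · rintro (⟨h1, h2, h3⟩ | ⟨h1, h2, h3⟩)
        · exact ⟨h1, h2, by linarith⟩
        · exact ⟨h1, by linarith, h3⟩
    · rw [Set.disjoint_left]
      rintro c ⟨-, h1, h2⟩ ⟨-, h3, h4⟩
      linarith
    · exact (hsec _).inter measurableSet_Ioc
  simp_rw [e1, e2]
  rw [ENNReal.tsum_add, ENNReal.tsum_add]
  congr 1
  · exact Equiv.tsum_eq (Function.Involutive.toPerm (nb b) (nb_nb b))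
      (fun j => volume {c : ℝ | (j, c) ∈ B ∧ -(len b j * x) < c ∧ c ≤ 0})
  · exact Equiv.tsum_eq (Function.Involutive.toPerm (nb (!b)) (nb_nb (!b)))
      (fun j => volume {c : ℝ | (j, c) ∈ B ∧ 0 < c ∧ c ≤ len (!b) j * y})

theorem step_of_lt {b : Bool} {x y c : ℝ} {j : ℕ} (h : len (!b) j * y - len b j * x < c) :
    step b x y (j, c) = (nb b j, c - len (!b) j * y) := if_pos h

theorem step_of_le {b : Bool} {x y c : ℝ} {j : ℕ} (h : c ≤ len (!b) j * y - len b j * x) :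
    step b x y (j, c) = (nb (!b) j, c + len b j * x) := if_neg (not_lt.2 h)

theorem mapsTo_step (b : Bool) {x y : ℝ} (hx : 0 < x) (hy : 0 < y) :
    Set.MapsTo (step b x y) (strip b x y) (strip b x y) := by
  rintro ⟨j, c⟩ ⟨h1, h2⟩
  have hl := mul_nonneg (len_nonneg b j) hx.le
  have hw := mul_nonneg (len_nonneg (!b) j) hy.le
  have hl' := mul_nonneg (len_nonneg b (nb (!b) j)) hx.le
  have hw' := mul_nonneg (len_nonneg (!b) (nb b j)) hy.le
  simp only at h1 h2
  rcases lt_or_ge (len (!b) j * y - len b j * x) c with h | h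
  · rw [step_of_lt h]
    simp only [strip, Set.mem_ofPred_eq, len_nb]
    constructor <;> linarith
  · rw [step_of_le h]
    simp only [strip, Set.mem_ofPred_eq, len_nb]
    constructor <;> linarith

/-! ### Almost invariant sets and the affine symmetries of the staircase -/

/-- There is a set of finite measure that contains the first rectangles and is entered by orbits of
measure at most `ε`. -/
def AlmostInvariant (b : Bool) (x y : ℝ) (N : ℕ) (ε : ℝ≥0∞) : Prop :=
  ∃ K : Set (ℕ × ℝ), MeasurableSet K ∧ (∀ z, z.1 ≤ N → z ∈ K) ∧ flux b x y K ≠ ∞ ∧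
    flux b x y (step b x y ⁻¹' K \ K) ≤ ε

theorem AlmostInvariant.mono {b : Bool} {x y : ℝ} {N M : ℕ} {ε : ℝ≥0∞}
    (h : AlmostInvariant b x y N ε) (hM : M ≤ N) : AlmostInvariant b x y M ε := by
  obtain ⟨K, h1, h2, h3, h4⟩ := h
  exact ⟨K, h1, fun z hz => h2 z (hz.trans hM), h3, h4⟩

/-- `AlmostInvariant` also asks for points outside the strip. They carry no flux, so adding all of
them costs nothing. -/
theorem AlmostInvariant.of_strip {b : Bool} {x y : ℝ} (hx : 0 < x) (hy : 0 < y) {N : ℕ} {ε : ℝ≥0∞}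
    {K : Set (ℕ × ℝ)} (hK : MeasurableSet K) (hN : ∀ z ∈ strip b x y, z.1 ≤ N → z ∈ K)
    (hfin : flux b x y K ≠ ∞) (hle : flux b x y (step b x y ⁻¹' K \ K) ≤ ε) :
    AlmostInvariant b x y N ε := by
  refine ⟨K ∪ (strip b x y)ᶜ, hK.union (measurableSet_strip b x y).compl, ?_, ?_, ?_⟩
  · intro z hz
    by_cases hs : z ∈ strip b x y
    · exact Or.inl (hN z hs hz)
    · exact Or.inr hs
  · refine ne_top_of_le_ne_top hfin (measure_mono_ae ?_)
    filter_upwards [ae_mem_strip b x y] with z hz hz'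
    exact hz'.resolve_right (fun h => h hz)
  · refine le_trans (measure_mono_ae ?_) hle
    filter_upwards [ae_mem_strip b x y] with z hz hz'
    exact ⟨hz'.1.resolve_right (fun h => h (mapsTo_step b hx hy hz)), fun h => hz'.2 (Or.inl h)⟩

/-- For `b = false` this is the multitwist in the vertical cylinders. The transversal for `(x, y)`
is placed at the upper end of the longer one for `(x, y + 2x)`, by a shift of `2 * len (!b) j * x`.
The first return to this part is `step b x y`: after a sideways exit the steeper orbit makes one
extra full turn around the cylinder. Complete cylinders are preserved, which is why `N` has to be
closed under `nb (!b)`. -/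
theorem AlmostInvariant.add_twist {b : Bool} {x y : ℝ} (hx : 0 < x) (hy : 0 < y) {N : ℕ}
    (hN : ∀ j ≤ N, nb (!b) j ≤ N) {ε : ℝ≥0∞} (h : AlmostInvariant b x y N ε) :
    AlmostInvariant b x (y + 2 * x) N ε := by
  obtain ⟨K, hK, hKN, hfin, hle⟩ := h
  have hy' : 0 < y + 2 * x := by positivity
  have hφ : Measurable (fun z : ℕ × ℝ => (z.1, z.2 - 2 * len (!b) z.1 * x)) :=
    measurable_fst.prodMk (measurable_snd.sub (((measurable_len (!b)).const_mul 2).mul_const x))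
  have hA' : MeasurableSet {z : ℕ × ℝ | 2 * len (!b) z.1 * x - len b z.1 * x < z.2} :=
    measurableSet_lt ((((measurable_len (!b)).const_mul 2).mul_const x).sub
      ((measurable_len b).mul_const x)) measurable_snd
  -- Going around the cylinder raises the coordinate by `2 * len (!b) j * x` in two passages
  -- (`len_add_len_nb`), so the section is reached after at most two. If the rectangle has width
  -- zero, its whole transversal belongs to the section.
  have hhit : ∀ z ∈ strip b x (y + 2 * x),
      z ∈ {z : ℕ × ℝ | 2 * len (!b) z.1 * x - len b z.1 * x < z.2} ∨
      step b x (y + 2 * x) z ∈ {z : ℕ × ℝ | 2 * len (!b) z.1 * x - len b z.1 * x < z.2} ∧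
        (step b x (y + 2 * x) z).1 = nb (!b) z.1 ∨
      step b x (y + 2 * x) z ∉ {z : ℕ × ℝ | 2 * len (!b) z.1 * x - len b z.1 * x < z.2} ∧
      step b x (y + 2 * x) (step b x (y + 2 * x) z) ∈
        {z : ℕ × ℝ | 2 * len (!b) z.1 * x - len b z.1 * x < z.2} ∧
        (step b x (y + 2 * x) (step b x (y + 2 * x) z)).1 = z.1 := by
    rintro ⟨j, c⟩ ⟨h1, h2⟩
    simp only at h1 h2
    by_cases hc : 2 * len (!b) j * x - len b j * x < c
    · exact Or.inl hc
    rcases len_add_len_nb b j with hw | hw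
    swap
    · exact absurd (by rw [hw]; linarith) hc
    have hwy := mul_nonneg (len_nonneg (!b) j) hy.le
    have hwx := congrArg (· * x) hw
    have hl := mul_nonneg (len_nonneg b j) hx.le
    simp only [add_mul] at hwx
    rw [step_of_le (by linarith)]
    by_cases hc0 : 0 < c
    · right; left
      simp only [Set.mem_ofPred_eq, len_nb, and_true]
      linarith
    · right; right
      rw [step_of_le (by rw [len_nb]; linarith)]
      simp only [Set.mem_ofPred_eq, len_nb, nb_nb, and_true]
      constructor <;> linarith
  obtain ⟨K', hK', hfin', hle', hmem⟩ := exists_almost_invariant_transfer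
    (measurePreserving_step b hx hy) (measurePreserving_step b hx hy') (A := Set.univ) (K := K)
    (A' := {z : ℕ × ℝ | 2 * len (!b) z.1 * x - len b z.1 * x < z.2})
    (φ := fun z => (z.1, z.2 - 2 * len (!b) z.1 * x)) MeasurableSet.univ hA' hK hφ
    (by
      intro B hB
      rw [Set.univ_inter, flux_apply _ _ _ hB, flux_apply _ _ _ (hA'.inter (hφ hB))]
      refine ENNReal.tsum_le_tsum fun j => ?_
      rw [← measure_preimage_add_right volume (-(2 * len (!b) j * x)) {c : ℝ | (j, c) ∈ B ∧ _}]
      refine measure_mono ?_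
      rintro c ⟨⟨h1, h2⟩, h3, h4⟩
      simp only [Set.mem_preimage, Set.mem_ofPred_eq] at h1 h2 h3 h4 ⊢
      exact ⟨h2, by linarith, by linarith⟩) hfin
    (by
      filter_upwards [ae_mem_strip b x (y + 2 * x)] with z hz
      have := hhit z hz
      tauto)
    (by
      filter_upwards [ae_mem_strip b x (y + 2 * x)] with z hz hzA
      refine ⟨trivial, ?_⟩
      suffices hs : ∃ w, ReturnsTo (step b x (y + 2 * x))
          {z : ℕ × ℝ | 2 * len (!b) z.1 * x - len b z.1 * x < z.2} z w ∧
          (w.1, w.2 - 2 * len (!b) w.1 * x) = step b x y (z.1, z.2 - 2 * len (!b) z.1 * x) by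
        obtain ⟨w, h1, h2⟩ := hs
        exact ⟨w, h1, Or.inl ⟨trivial, h2⟩⟩
      obtain ⟨j, c⟩ := z
      obtain ⟨h1, h2⟩ := hz
      simp only at hzA
      simp only at h1 h2 ⊢
      -- A sideways exit for `(x, y)` corresponds to one sideways step followed by a full turn,
      -- three steps in all, or just one if the next rectangle is degenerate. In the other case both
      -- orbits go up once.
      rcases lt_or_ge (len (!b) j * y - len b j * x) (c - 2 * len (!b) j * x) with h | h
      · rw [step_of_lt h]
        have hs : step b x (y + 2 * x) (j, c) = (nb b j, c - len (!b) j * (y + 2 * x)) :=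
          step_of_lt (by linarith)
        rcases len_add_len_nb b (nb b j) with hw | hw
        · have hwy := mul_nonneg (len_nonneg (!b) (nb b j)) hy.le
          have hwx := congrArg (· * x) hw
          have hl := mul_nonneg (len_nonneg b (nb (!b) (nb b j))) hx.le
          have hl' := mul_nonneg (len_nonneg b j) hx.le
          simp only [add_mul, len_nb] at hwx
          have hs2 : step b x (y + 2 * x) (nb b j, c - len (!b) j * (y + 2 * x)) = _ :=
            step_of_le (by rw [len_nb]; linarith)
          rw [len_nb] at hs2
          have hs3 := step_of_le (b := b) (x := x) (y := y + 2 * x) (j := nb (!b) (nb b j))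
            (c := c - len (!b) j * (y + 2 * x) + len b j * x) (by rw [len_nb]; linarith)
          rw [nb_nb] at hs3
          refine ⟨_, Or.inr (Or.inr ⟨?_, ?_, ?_, rfl⟩), ?_⟩
          · rw [hs]; simp only [Set.mem_ofPred_eq, len_nb, not_lt]; linarith
          · rw [hs, hs2]; simp only [Set.mem_ofPred_eq, len_nb, not_lt]; linarith
          · rw [hs, hs2, hs3]; simp only [Set.mem_ofPred_eq, len_nb]; linarith
          · rw [hs, hs2, hs3]
            ext
            · rfl
            · simp only; linarith
        · refine ⟨_, Or.inl ⟨?_, rfl⟩, ?_⟩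
          · rw [hs]; simp only [Set.mem_ofPred_eq, len_nb, hw]; linarith
          · rw [hs]
            ext
            · rfl
            · simp only [hw]; ring
      · rw [step_of_le h]
        have hs : step b x (y + 2 * x) (j, c) = (nb (!b) j, c + len b j * x) :=
          step_of_le (by linarith)
        rcases len_add_len_nb b j with hw | hw
        · have hwx := congrArg (· * x) hw
          have hl := mul_nonneg (len_nonneg b (nb (!b) j)) hx.le
          simp only [add_mul] at hwx
          refine ⟨_, Or.inl ⟨?_, rfl⟩, ?_⟩
          · rw [hs]; simp only [Set.mem_ofPred_eq, len_nb]; linarith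
          · rw [hs]
            ext
            · rfl
            · simp only [len_nb]; ring
        · rw [hw] at h h2
          linarith)
  refine AlmostInvariant.of_strip hx hy' hK' ?_ hfin' (hle'.trans hle)
  intro z hz hzN
  by_cases hzA : z ∈ {z : ℕ × ℝ | 2 * len (!b) z.1 * x - len b z.1 * x < z.2}
  · exact hmem z z (Or.inl rfl) hzA (hKN _ hzN)
  · rcases hhit z hz with h | ⟨h, h'⟩ | ⟨h, h', h''⟩
    · exact absurd h hzA
    · exact hmem z _ (Or.inr (Or.inl ⟨hzA, rfl⟩)) h (hKN _ (by simp only [h']; exact hN _ hzN))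
    · exact hmem z _ (Or.inr (Or.inr ⟨hzA, h, rfl⟩)) h' (hKN _ (by simp only [h'']; exact hzN))

/-- For `b = false` the map `(X, Y) ↦ (X, 2X - Y)` keeps every vertical cylinder and reverses its
circular direction. The sections are therefore the sideways exits from the cylinders, which both
flows cross in the same order. Since `2x = y + y'`, `φ` reverses the exit interval for `y'` onto the
one for `y`. Corner orbits, where the half-open ends disagree, are discarded as a null set. -/
theorem AlmostInvariant.reflect {b : Bool} {x y : ℝ} (hx : 0 < x) (hy : 0 < y) (hyx : y < 2 * x)
    {N : ℕ} (hN : ∀ j ≤ N, nb (!b) j ≤ N) {ε : ℝ≥0∞} (h : AlmostInvariant b x y N ε) :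
    AlmostInvariant b x (2 * x - y) N ε := by
  obtain ⟨K, hK, hKN, hfin, hle⟩ := h
  obtain ⟨y', hyy'⟩ : ∃ y', y' = 2 * x - y := ⟨_, rfl⟩
  rw [← hyy']
  have hy' : 0 < y' := by linarith
  have hφ : Measurable (fun z : ℕ × ℝ => (z.1, 2 * len (!b) z.1 * x - len b z.1 * x - z.2)) :=
    measurable_fst.prodMk (((((measurable_len (!b)).const_mul 2).mul_const x).sub
      ((measurable_len b).mul_const x)).sub measurable_snd)
  have hAm : ∀ t, MeasurableSet {z : ℕ × ℝ | len (!b) z.1 * t - len b z.1 * x < z.2} := fun t =>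
    measurableSet_lt (((measurable_len (!b)).mul_const t).sub
      ((measurable_len b).mul_const x)) measurable_snd
  have hW : ∀ j, 2 * len (!b) j * x = len (!b) j * y + len (!b) j * y' := by
    intro j; rw [hyy']; ring
  have hhit : ∀ z ∈ strip b x y',
      z ∈ {z : ℕ × ℝ | len (!b) z.1 * y' - len b z.1 * x < z.2} ∨
      step b x y' z ∈ {z : ℕ × ℝ | len (!b) z.1 * y' - len b z.1 * x < z.2} ∧
        (step b x y' z).1 = nb (!b) z.1 ∨
      step b x y' z ∉ {z : ℕ × ℝ | len (!b) z.1 * y' - len b z.1 * x < z.2} ∧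
      step b x y' (step b x y' z) ∈
        {z : ℕ × ℝ | len (!b) z.1 * y' - len b z.1 * x < z.2} ∧
        (step b x y' (step b x y' z)).1 = z.1 := by
    rintro ⟨j, c⟩ ⟨h1, h2⟩
    simp only at h1 h2
    by_cases hc : len (!b) j * y' - len b j * x < c
    · exact Or.inl hc
    rcases len_add_len_nb b j with hw | hw
    swap
    · exact absurd (by rw [hw]; linarith) hc
    have hwy := mul_nonneg (len_nonneg (!b) j) hy.le
    have hwx := congrArg (· * x) hw
    simp only [add_mul] at hwx
    rw [step_of_le (by linarith)]
    by_cases hc0 : len (!b) j * y' - len b (nb (!b) j) * x < c + len b j * x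
    · right; left
      simp only [Set.mem_ofPred_eq, len_nb, and_true]
      linarith
    · right; right
      rw [step_of_le (by rw [len_nb]; linarith)]
      simp only [Set.mem_ofPred_eq, len_nb, nb_nb, and_true]
      constructor
      · linarith
      · linarith [hW j]
  obtain ⟨K', hK', hfin', hle', hmem⟩ := exists_almost_invariant_transfer
    (measurePreserving_step b hx hy) (measurePreserving_step b hx hy')
    (A := {z : ℕ × ℝ | len (!b) z.1 * y - len b z.1 * x < z.2}) (K := K)
    (A' := {z : ℕ × ℝ | len (!b) z.1 * y' - len b z.1 * x < z.2})
    (φ := fun z => (z.1, 2 * len (!b) z.1 * x - len b z.1 * x - z.2)) (hAm y) (hAm y') hK hφ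
    (by
      intro B hB
      rw [flux_apply _ _ _ ((hAm y).inter hB), flux_apply _ _ _ ((hAm y').inter (hφ hB))]
      refine ENNReal.tsum_le_tsum fun j => ?_
      have hm : MeasurableSet {c : ℝ | (j, c) ∈ {z : ℕ × ℝ |
          len (!b) z.1 * y - len b z.1 * x < z.2} ∩ B ∧ -(len b j * x) < c ∧
          c ≤ len (!b) j * y} :=
        (measurable_prodMk_left ((hAm y).inter hB)).inter measurableSet_Ioc
      rw [← (Measure.measurePreserving_sub_left volume
        (2 * len (!b) j * x - len b j * x)).measure_preimage hm.nullMeasurableSet]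
      refine measure_mono_ae ?_
      have hne : ∀ᵐ c : ℝ, c ≠ len (!b) j * y' := by
        simp [ae_iff]
      filter_upwards [hne] with c hc hc'
      obtain ⟨⟨h1, h2⟩, h3, h4⟩ := hc'
      have h5 := lt_of_le_of_ne h4 hc
      simp only [Set.mem_preimage, Set.mem_ofPred_eq] at h1 h2 h3 h4
      have := hW j
      have hwy := mul_nonneg (len_nonneg (!b) j) hy.le
      change (_ ∧ _) ∧ _ ∧ _
      simp only [Set.mem_ofPred_eq]
      refine ⟨⟨?_, h2⟩, ?_, ?_⟩ <;> linarith) hfin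
    (by
      filter_upwards [ae_mem_strip b x y'] with z hz
      have := hhit z hz
      tauto)
    (by
      filter_upwards [ae_mem_strip b x y', ae_ne_flux b x y' (fun j => len (!b) j * y'),
        ae_ne_flux b x y' (fun j => len (!b) j * y' + len (!b) (nb b j) * y' - len b j * x),
        ae_ne_flux b x y' (fun j => len (!b) j * y' - len (!b) (nb b j) * y)] with
        z hz hn1 hn2 hn3 hzA
      obtain ⟨j, c⟩ := z
      obtain ⟨h1, h2⟩ := hz
      simp only at hzA
      simp only at h1 h2 hn1 hn2 hn3 ⊢
      have hWj := hW j
      have hWr := hW (nb b j)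
      have h5 := lt_of_le_of_ne h2 hn1
      obtain ⟨e, he⟩ : ∃ e, e = c - len (!b) j * y' := ⟨_, rfl⟩
      have hs' : step b x y' (j, c) = (nb b j, e) := by rw [he]; exact step_of_lt hzA
      have hs : step b x y (j, 2 * len (!b) j * x - len b j * x - c) =
          (nb b j, -(len b j * x) - e) := by
        rw [step_of_lt (by linarith)]
        ext
        · rfl
        · simp only; linarith
      refine ⟨by linarith, ?_⟩
      rcases len_add_len_nb b (nb b j) with hw | hw
      swap
      · refine ⟨_, Or.inl ⟨?_, rfl⟩, Or.inl ⟨?_, ?_⟩⟩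
        · rw [hs']; simp only [Set.mem_ofPred_eq, len_nb, hw]; linarith
        · rw [hs']; simp only [Set.mem_ofPred_eq, len_nb, hw]; linarith
        · rw [hs', hs]
          ext
          · rfl
          · simp only [hw, len_nb]; ring
      have hwx := congrArg (· * x) hw
      have hwy := mul_nonneg (len_nonneg (!b) (nb b j)) hy.le
      have hwy' := mul_nonneg (len_nonneg (!b) (nb b j)) hy'.le
      have hl' := mul_nonneg (len_nonneg b (nb (!b) (nb b j))) hx.le
      simp only [add_mul, len_nb] at hwx
      have up : ∀ t c', c' ≤ len (!b) (nb b j) * t - len b j * x →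
          step b x t (nb b j, c') = (nb (!b) (nb b j), c' + len b j * x) := by
        intro t c' hc'
        have := step_of_le (b := b) (x := x) (y := t) (c := c') (j := nb b j)
          (by rw [len_nb]; exact hc')
        rwa [len_nb] at this
      have up2 : ∀ t c', c' ≤ len (!b) (nb b j) * t - len b (nb (!b) (nb b j)) * x →
          step b x t (nb (!b) (nb b j), c') =
            (nb b j, c' + len b (nb (!b) (nb b j)) * x) := by
        intro t c' hc'
        have := step_of_le (b := b) (x := x) (y := t) (c := c') (j := nb (!b) (nb b j))
          (by rw [len_nb]; exact hc')
        rwa [nb_nb] at this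
      -- In crossing a nondegenerate cylinder, the two orbits climb by heights whose sum is the
      -- circumference. Their numbers of upward passages are `0` and `2`, `1` and `1`, or `2` and
      -- `0`, and these are the three cases.
      rcases lt_or_ge (len (!b) (nb b j) * y' - len b j * x) e with hA | hA
      · have u1 := up y (-(len b j * x) - e) (by linarith)
        have u2 := up2 y (-(len b j * x) - e + len b j * x) (by linarith)
        refine ⟨_, Or.inl ⟨?_, rfl⟩, Or.inr (Or.inr ⟨?_, ?_, ?_, ?_⟩)⟩
        · rw [hs']; simp only [Set.mem_ofPred_eq, len_nb]; linarith
        · rw [hs]; simp only [Set.mem_ofPred_eq, len_nb]; linarith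
        · rw [hs, u1]; simp only [Set.mem_ofPred_eq, len_nb]; linarith
        · rw [hs']; simp only [Set.mem_ofPred_eq, len_nb]; linarith
        · rw [hs', hs, u1, u2]
          ext
          · rfl
          · simp only [len_nb]; linarith
      have hA' : e < len (!b) (nb b j) * y' - len b j * x :=
        lt_of_le_of_ne hA (fun h => hn2 (by linarith))
      have u1' := up y' e hA
      rcases lt_or_ge (-(len (!b) (nb b j) * y)) e with hB | hB
      · have u1 := up y (-(len b j * x) - e) (by linarith)
        refine ⟨_, Or.inr (Or.inl ⟨?_, ?_, rfl⟩), Or.inr (Or.inl ⟨?_, ?_, ?_⟩)⟩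
        · rw [hs']; simp only [Set.mem_ofPred_eq, len_nb]; linarith
        · rw [hs', u1']; simp only [Set.mem_ofPred_eq, len_nb]; linarith
        · rw [hs]; simp only [Set.mem_ofPred_eq, len_nb]; linarith
        · rw [hs', u1']; simp only [Set.mem_ofPred_eq, len_nb]; linarith
        · rw [hs', hs, u1, u1']
          ext
          · rfl
          · simp only [len_nb]; linarith
      have hB' : e < -(len (!b) (nb b j) * y) :=
        lt_of_le_of_ne hB (fun h => hn3 (by linarith))
      have u2' := up2 y' (e + len b j * x) (by linarith)
      refine ⟨_, Or.inr (Or.inr ⟨?_, ?_, ?_, rfl⟩), Or.inl ⟨?_, ?_⟩⟩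
      · rw [hs']; simp only [Set.mem_ofPred_eq, len_nb]; linarith
      · rw [hs', u1']; simp only [Set.mem_ofPred_eq, len_nb]; linarith
      · rw [hs', u1', u2']; simp only [Set.mem_ofPred_eq, len_nb]; linarith
      · rw [hs', u1', u2']; simp only [Set.mem_ofPred_eq, len_nb]; linarith
      · rw [hs', hs, u1', u2']
        ext
        · rfl
        · simp only [len_nb]; linarith)
  refine AlmostInvariant.of_strip hx hy' hK' ?_ hfin' (hle'.trans hle)
  intro z hz hzN
  by_cases hzA : z ∈ {z : ℕ × ℝ | len (!b) z.1 * y' - len b z.1 * x < z.2}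
  · exact hmem z z (Or.inl rfl) hzA (hKN _ hzN)
  · rcases hhit z hz with h | ⟨h, h'⟩ | ⟨h, h', h''⟩
    · exact absurd h hzA
    · exact hmem z _ (Or.inr (Or.inl ⟨hzA, rfl⟩)) h (hKN _ (by simp only [h']; exact hN _ hzN))
    · exact hmem z _ (Or.inr (Or.inr ⟨hzA, h, rfl⟩)) h' (hKN _ (by simp only [h'']; exact hzN))

/-- Transposing the staircase exchanges the two pairings and changes the sign of the coordinate;
only interval ends and exit corners, a null set, are affected by the half-open conventions. -/
theorem AlmostInvariant.swap {b : Bool} {x y : ℝ} (hx : 0 < x) (hy : 0 < y) {N : ℕ} {ε : ℝ≥0∞}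
    (h : AlmostInvariant b x y N ε) : AlmostInvariant (!b) y x N ε := by
  obtain ⟨K, hK, hKN, hfin, hle⟩ := h
  have hφ : Measurable (fun z : ℕ × ℝ => (z.1, -z.2)) := measurable_fst.prodMk measurable_snd.neg
  obtain ⟨K', hK', hfin', hle', hmem⟩ := exists_almost_invariant_transfer
    (measurePreserving_step b hx hy) (measurePreserving_step (!b) hy hx)
    (A := Set.univ) (A' := Set.univ) (φ := fun z : ℕ × ℝ => (z.1, -z.2)) MeasurableSet.univ
    MeasurableSet.univ hK hφ
    (by
      intro B hB
      rw [Set.univ_inter, Set.univ_inter, flux_apply _ _ _ hB, flux_apply _ _ _ (hφ hB)]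
      refine ENNReal.tsum_le_tsum fun j => ?_
      have hm : MeasurableSet {c : ℝ | (j, c) ∈ B ∧ -(len b j * x) < c ∧ c ≤ len (!b) j * y} :=
        (measurable_prodMk_left hB).inter measurableSet_Ioc
      rw [← (Measure.measurePreserving_neg volume).measure_preimage hm.nullMeasurableSet]
      refine measure_mono_ae ?_
      have hne : ∀ᵐ c : ℝ, c ≠ len b j * x := by
        simp [ae_iff]
      filter_upwards [hne] with c hc hc'
      obtain ⟨h2, h3, h4⟩ := hc'
      rw [Bool.not_not] at h4
      have h5 := lt_of_le_of_ne h4 hc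
      exact ⟨h2, by linarith, by linarith⟩) hfin
    (by simp)
    (by
      filter_upwards [ae_ne_flux (!b) y x (fun j => len b j * x - len (!b) j * y)] with z hz _
      refine ⟨trivial, _, Or.inl ⟨trivial, rfl⟩, Or.inl ⟨trivial, ?_⟩⟩
      obtain ⟨j, c⟩ := z
      simp only at hz
      rcases lt_or_ge (len b j * x - len (!b) j * y) c with h | h
      · rw [step_of_lt (by rwa [Bool.not_not]), step_of_le (by linarith), Bool.not_not]
        ext
        · rfl
        · simp only; ring
      · have h' := lt_of_le_of_ne h hz
        rw [step_of_le (by rwa [Bool.not_not]), step_of_lt (by linarith), Bool.not_not]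
        ext
        · rfl
        · simp only; ring)
  exact ⟨K', hK', fun z hz => hmem z z (Or.inl rfl) trivial (hKN _ hz), hfin', hle'.trans hle⟩

/-- The rectangles up to `N` are closed under `nb (!b)`, so orbits can enter only through the
pairing `nb b`. As that changes the index by at most one, they enter through a single side of
rectangle `N`, of length `len b N ≤ N + 1`. -/
theorem almostInvariant_initial {b : Bool} {x y : ℝ} (hx : 0 < x) (hy : 0 < y) {N : ℕ}
    (hN : ∀ j ≤ N, nb (!b) j ≤ N) : AlmostInvariant b x y N (ENNReal.ofReal ((N + 1) * x)) := by
  have hm : MeasurableSet {z : ℕ × ℝ | z.1 ≤ N} := measurableSet_le measurable_fst measurable_const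
  have hm' : MeasurableSet {z : ℕ × ℝ | z.1 = N ∧ z.2 ≤ 0} :=
    (measurableSet_eq_fun measurable_fst measurable_const).inter
      (measurableSet_le measurable_snd measurable_const)
  refine ⟨{z | z.1 ≤ N}, hm, fun z hz => hz, ?_, ?_⟩
  · rw [flux_apply _ _ _ hm, tsum_eq_sum (s := Finset.range (N + 1))]
    · refine (ENNReal.sum_lt_top.2 fun j _ => ?_).ne
      refine lt_of_le_of_lt (measure_mono fun c hc => hc.2) (?_ : volume (Set.Ioc _ _) < ∞)
      simp
    · intro j hj
      have : ¬ j ≤ N := by simpa [Nat.lt_succ_iff] using hj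
      simp [this]
  · calc flux b x y (step b x y ⁻¹' {z | z.1 ≤ N} \ {z | z.1 ≤ N})
        ≤ flux b x y (step b x y ⁻¹' {z | z.1 = N ∧ z.2 ≤ 0}) := by
          refine measure_mono_ae ?_
          filter_upwards [ae_mem_strip b x y] with z hz hz'
          obtain ⟨j, c⟩ := z
          obtain ⟨h1, h2⟩ := hz'
          simp only [Set.mem_preimage, Set.mem_ofPred_eq] at h1 h2
          change _ ∧ _
          rcases lt_or_ge (len (!b) j * y - len b j * x) c with h | h
          · rw [step_of_lt h] at h1 ⊢
            have h3 := nb_le b (nb b j)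
            rw [nb_nb] at h3
            simp only at h1
            refine ⟨by simp only; omega, ?_⟩
            have := hz.2
            simp only at this ⊢
            linarith
          · rw [step_of_le h] at h1
            have h3 := hN _ h1
            rw [nb_nb] at h3
            exact absurd h3 h2
      _ = flux b x y {z | z.1 = N ∧ z.2 ≤ 0} :=
          (measurePreserving_step b hx hy).measure_preimage hm'.nullMeasurableSet
      _ ≤ ENNReal.ofReal ((N + 1) * x) := by
          rw [flux_apply _ _ _ hm', tsum_eq_single N]
          · refine (measure_mono (t := Set.Ioc (-(len b N * x)) 0) ?_).trans ?_
            · rintro c ⟨⟨-, h1⟩, h2, -⟩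
              exact ⟨h2, h1⟩
            · rw [Real.volume_Ioc]
              refine ENNReal.ofReal_le_ofReal ?_
              have := mul_le_mul_of_nonneg_right (len_le b N) hx.le
              linarith
          · intro j hj
            simp [hj]

/-! ### The Euclidean algorithm with even quotients -/

/-- `s` is the distance from `p` to the nearest even multiple of `q`. Irrationality keeps it away
from `0` and `q`, and `p > q` excludes the multiple `0`. -/
theorem exists_even_division {p q : ℝ} (hq : 0 < q) (hqp : q < p) (h : Irrational (p / q)) :
    ∃ s : ℝ, 0 < s ∧ s < q ∧ Irrational (q / s) ∧
      ∃ a : ℕ, 1 ≤ a ∧ (p = 2 * a * q + s ∨ p = 2 * a * q - s) := by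
  set t := p / q with ht
  have hp : p = t * q := by rw [ht]; field_simp
  have ht1 : 1 < t := by rw [ht, lt_div_iff₀ hq]; linarith
  set a := round (t / 2) with ha
  have h1 : |t / 2 - a| ≤ 1 / 2 := abs_sub_round _
  have hirr : Irrational (t - 2 * a) := by
    have := h.sub_intCast (2 * a)
    push_cast at this
    exact this
  have h2 : |t - 2 * a| ≤ 1 := by
    have : t - 2 * a = 2 * (t / 2 - a) := by ring
    rw [this, abs_mul, abs_two]; linarith
  have hne1 : |t - 2 * a| ≠ 1 := by
    intro h3
    rcases (abs_eq zero_le_one).1 h3 with h4 | h4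
    · exact hirr.ne_one h4
    · exact hirr ⟨-1, by rw [h4]; simp⟩
  have hpos : 0 < |t - 2 * a| := abs_pos.2 hirr.ne_zero
  have ha1 : 1 ≤ a := by
    have h5 : (0 : ℝ) < a := by
      have := (abs_le.1 h1).2
      linarith
    have : 0 < a := by exact_mod_cast h5
    omega
  have hirr' : Irrational |t - 2 * a| := by
    rcases abs_choice (t - 2 * a) with h3 | h3 <;> rw [h3]
    · exact hirr
    · exact hirr.neg
  refine ⟨|t - 2 * a| * q, by positivity, ?_, ?_, a.toNat, by omega, ?_⟩
  · have := lt_of_le_of_ne h2 hne1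
    nlinarith
  · have : q / (|t - 2 * a| * q) = |t - 2 * a|⁻¹ := by field_simp
    rw [this]
    exact hirr'.inv
  · have hcast : ((a.toNat : ℕ) : ℝ) = a := by
      have : ((a.toNat : ℤ) : ℝ) = a := by rw [Int.toNat_of_nonneg (by omega)]
      exact_mod_cast this
    rw [hcast, hp]
    rcases abs_choice (t - 2 * a) with h3 | h3 <;> rw [h3]
    · left; ring
    · right; ring

/-- `r` is the sequence of remainders of the Euclidean algorithm with even quotients. -/
def IsEvenEuclid (r : ℕ → ℝ) : Prop :=
  ∀ k, 0 < r (k + 1) ∧ r (k + 1) < r k ∧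
    ∃ a : ℕ, 1 ≤ a ∧
      (r k = 2 * a * r (k + 1) + r (k + 2) ∨ r k = 2 * a * r (k + 1) - r (k + 2))

theorem exists_isEvenEuclid {p q : ℝ} (hq : 0 < q) (hqp : q < p) (h : Irrational (p / q)) :
    ∃ r, IsEvenEuclid r ∧ r 0 = p ∧ r 1 = q := by
  let S := {u : ℝ × ℝ // 0 < u.2 ∧ u.2 < u.1 ∧ Irrational (u.1 / u.2)}
  have hex : ∀ u : S, ∃ w : S, w.1.1 = u.1.2 ∧ ∃ a : ℕ, 1 ≤ a ∧
      (u.1.1 = 2 * a * u.1.2 + w.1.2 ∨ u.1.1 = 2 * a * u.1.2 - w.1.2) := by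
    rintro ⟨⟨p, q⟩, hq, hqp, h⟩
    obtain ⟨s, h1, h2, h3, h4⟩ := exists_even_division hq hqp h
    exact ⟨⟨(q, s), h1, h2, h3⟩, rfl, h4⟩
  choose f hf hf' using hex
  let u : ℕ → S := fun n => f^[n] ⟨(p, q), hq, hqp, h⟩
  have hu : ∀ n, u (n + 1) = f (u n) := fun n => Function.iterate_succ_apply' f n _
  have hu1 : ∀ n, (u (n + 1)).1.1 = (u n).1.2 := fun n => by rw [hu, hf]
  refine ⟨fun n => (u n).1.1, fun k => ⟨?_, ?_, ?_⟩, rfl, ?_⟩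
  · exact (u k).2.1.trans_eq (hu1 k).symm
  · exact (hu1 k).trans_lt (u k).2.2.1
  · have h1 := hf' (u k)
    rw [← hu] at h1
    simp only [hu1, show k + 2 = k + 1 + 1 from rfl]
    exact h1
  · exact hu1 0

theorem IsEvenEuclid.pos {r : ℕ → ℝ} (hr : IsEvenEuclid r) (k : ℕ) : 0 < r k :=
  (hr k).1.trans (hr k).2.1

theorem IsEvenEuclid.antitone {r : ℕ → ℝ} (hr : IsEvenEuclid r) : Antitone r :=
  antitone_nat_of_succ_le fun k => (hr k).2.1.le

/-- The differences of the remainders decrease. -/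
theorem IsEvenEuclid.antitone_sub {r : ℕ → ℝ} (hr : IsEvenEuclid r) :
    Antitone fun k => r k - r (k + 1) := by
  refine antitone_nat_of_succ_le fun k => ?_
  obtain ⟨h1, -, a, ha, h⟩ := hr k
  have h2 := hr.pos (k + 2)
  have ha' : (1 : ℝ) ≤ a := by exact_mod_cast ha
  change r (k + 1) - r (k + 2) ≤ r k - r (k + 1)
  rcases h with h | h <;> nlinarith

/-- Otherwise every quotient from some point on is `2`, with a minus sign. The remainders then form
a decreasing arithmetic progression, which cannot stay positive. -/
theorem IsEvenEuclid.frequently_jump {r : ℕ → ℝ} (hr : IsEvenEuclid r) (n : ℕ) :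
    ∃ k ≥ n, r (k + 1) ≤ r k - r (k + 1) := by
  by_contra! hcon
  have hlin : ∀ k ≥ n, r (k + 1) - r (k + 2) = r k - r (k + 1) := by
    intro k hk
    obtain ⟨h1, h1', a, ha, h⟩ := hr k
    have h2 := hr.pos (k + 2)
    have h3 := hcon k hk
    have h4 := (hr (k + 1)).2.1
    have h5 : r (k + 1 + 1) = r (k + 2) := rfl
    have ha' : (1 : ℝ) ≤ a := by exact_mod_cast ha
    rcases h with h | h
    · nlinarith
    · rcases Nat.lt_or_ge a 2 with ha2 | ha2
      · have : a = 1 := by omega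
        subst this
        push_cast at h
        linarith
      · have ha'' : (2 : ℝ) ≤ a := by exact_mod_cast ha2
        nlinarith
  have hd : ∀ m, r (n + m) - r (n + m + 1) = r n - r (n + 1) := by
    intro m
    induction m with
    | zero => rfl
    | succ m ih => rw [← ih]; exact hlin (n + m) (by omega)
  have hr' : ∀ m : ℕ, r (n + m) = r n - m * (r n - r (n + 1)) := by
    intro m
    induction m with
    | zero => simp
    | succ m ih =>
      have := hd m
      have e : n + (m + 1) = n + m + 1 := by ring
      rw [e]
      push_cast
      linarith
  have hpos : 0 < r n - r (n + 1) := sub_pos.2 (hr n).2.1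
  obtain ⟨m, hm⟩ := exists_nat_gt (r n / (r n - r (n + 1)))
  rw [div_lt_iff₀ hpos] at hm
  have := hr.pos (n + m)
  rw [hr' m] at this
  linarith

/-- The differences of the remainders decrease and have a finite sum, so `k` times the `k`-th one
tends to zero. At the indices of `frequently_jump` the difference bounds `r (k + 1)`. -/
theorem IsEvenEuclid.exists_mul_lt {r : ℕ → ℝ} (hr : IsEvenEuclid r) (C : ℕ) {ε : ℝ} (hε : 0 < ε) :
    ∃ k : ℕ, ((k : ℝ) + C) * r (k + 1) < ε := by
  have hlim := tendsto_atTop_ciInf hr.antitone ⟨0, by rintro _ ⟨k, rfl⟩; exact (hr.pos k).le⟩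
  obtain ⟨n, hn⟩ := (Metric.cauchySeq_iff'.1 hlim.cauchySeq) (ε / 2) (by positivity)
  -- After `n` the remainders are within `ε / 2` of `r n`. The bound `2 * n + C` gives `k + C ≤ 2 *
  -- (k - n)`, so `k - n` differences, each at least the `k`-th one, suffice.
  obtain ⟨k, hk, hjump⟩ := hr.frequently_jump (2 * n + C)
  refine ⟨k, ?_⟩
  have hsum : ∀ m ≤ k - n, (m : ℝ) * (r k - r (k + 1)) ≤ r (k - m) - r k := by
    intro m hm
    induction m with
    | zero => simp
    | succ m ih =>
      have h1 := ih (by omega)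
      have h2 := hr.antitone_sub (show k - (m + 1) ≤ k by omega)
      have e : k - (m + 1) + 1 = k - m := by omega
      simp only [e] at h2
      push_cast
      linarith
  have h1 := hsum (k - n) le_rfl
  rw [show k - (k - n) = n by omega] at h1
  have h2 := hn k (by omega)
  rw [Real.dist_eq, abs_lt] at h2
  have h3 : ((k : ℝ) + C) ≤ 2 * ((k - n : ℕ) : ℝ) := by
    have : k + C ≤ 2 * (k - n) := by omega
    exact_mod_cast this
  have h4 : 0 ≤ r k - r (k + 1) := sub_nonneg.2 (hr k).2.1.le
  calc ((k : ℝ) + C) * r (k + 1) ≤ ((k : ℝ) + C) * (r k - r (k + 1)) := by gcongr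
    _ ≤ 2 * ((k - n : ℕ) : ℝ) * (r k - r (k + 1)) := by gcongr
    _ < ε := by linarith

/-! ### Conservativity of the staircase map -/

theorem AlmostInvariant.twists {b : Bool} {x y : ℝ} (hx : 0 < x) (hy : 0 < y) {N : ℕ}
    (hN : ∀ j ≤ N, nb (!b) j ≤ N) {ε : ℝ≥0∞} (h : AlmostInvariant b x y N ε) (a : ℕ) :
    AlmostInvariant b x (2 * a * x + y) N ε := by
  induction a with
  | zero => simpa using h
  | succ a ih =>
    have := ih.add_twist hx (by positivity) hN
    convert this using 1
    push_cast
    ring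

/-- The induction runs the algorithm backwards. One division step exchanges the roles of the two
directions, hence `!b`, and the number of rectangles must change parity for the cylinders to be
complete, hence `N + 1`. So the length factor grows by only one per division, while the remainder
moves on to the next. -/
theorem almostInvariant_of_isEvenEuclid (k : ℕ) : ∀ (b : Bool) (N : ℕ) (r : ℕ → ℝ), IsEvenEuclid r →
    (N % 2 = 1 ↔ b = true) →
    AlmostInvariant b (r 1) (r 0) N (ENNReal.ofReal ((k + (N + 1 : ℕ)) * r (k + 1))) := by
  have closed : ∀ (b : Bool) (N : ℕ), (N % 2 = 1 ↔ b = true) → ∀ j ≤ N, nb (!b) j ≤ N := by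
    intro b N hN j hj
    cases b
    · obtain ⟨m, rfl⟩ : ∃ m, N = 2 * m := ⟨N / 2, by simp at hN; omega⟩
      exact nb_true_le hj
    · obtain ⟨m, rfl⟩ : ∃ m, N = 2 * m + 1 := ⟨N / 2, by simp at hN; omega⟩
      exact nb_false_le hj
  induction k with
  | zero =>
    intro b N r hr hN
    have := almostInvariant_initial (hr.pos 1) (hr.pos 0) (closed b N hN)
    simpa using this
  | succ k ih =>
    intro b N r hr hN
    have h1 := ih (!b) (N + 1) (fun n => r (n + 1)) (fun n => hr (n + 1)) (by
      cases b <;> simp at hN ⊢ <;> omega)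
    have h2 := (h1.swap (hr.pos 2) (hr.pos 1)).mono (Nat.le_succ N)
    rw [Bool.not_not] at h2
    have e : ENNReal.ofReal (((k : ℝ) + (N + 1 + 1 : ℕ)) * r (k + 1 + 1)) =
        ENNReal.ofReal (((k + 1 : ℕ) + (N + 1 : ℕ)) * r (k + 1 + 1)) := by
      congr 2
      push_cast
      ring
    rw [e] at h2
    obtain ⟨-, -, a, ha, h⟩ := hr 0
    have hlt := (hr 1).2.1
    have hp1 := hr.pos 1
    have hp2 := hr.pos 2
    simp only [zero_add] at h hlt
    change r 2 < r 1 at hlt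
    rcases h with h | h
    · rw [h]
      exact h2.twists hp1 hp2 (closed b N hN) a
    -- Here `2 a r₁ - r₂ = 2 (a - 1) r₁ + (2 r₁ - r₂)`: one reflection followed by `a - 1` twists.
    · have h3 := (h2.reflect hp1 hp2 (by linarith) (closed b N hN)).twists hp1 (by linarith)
        (closed b N hN) (a - 1)
      rw [h]
      convert h3 using 1
      rw [Nat.cast_sub ha]
      push_cast
      ring

/-- The flow in an irrational direction is conservative. -/
theorem conservative_step (b : Bool) {x y : ℝ} (hx : 0 < x) (hy : 0 < y) (h : Irrational (y / x)) :
    Conservative (step b x y) (flux b x y) := by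
  have main : ∀ (b : Bool) (x y : ℝ), 0 < x → x < y → Irrational (y / x) → ∀ (n : ℕ) (ε : ℝ≥0∞),
      ε ≠ 0 → ∃ δ ≤ ε, AlmostInvariant b x y n δ := by
    intro b x y hx hxy h n ε hε
    obtain ⟨r, hr, h0, h1⟩ := exists_isEvenEuclid hx hxy h
    obtain ⟨N, hnN, hN⟩ : ∃ N ≥ n, (N % 2 = 1 ↔ b = true) := by
      cases b
      · exact ⟨2 * n, by omega, by simp⟩
      · exact ⟨2 * n + 1, by omega, by simp⟩
    obtain ⟨ε', hε', hle⟩ : ∃ ε' : ℝ, 0 < ε' ∧ ENNReal.ofReal ε' ≤ ε := by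
      rcases eq_or_ne ε ∞ with rfl | htop
      · exact ⟨1, one_pos, le_top⟩
      · exact ⟨ε.toReal, ENNReal.toReal_pos hε htop, ENNReal.ofReal_toReal_le⟩
    obtain ⟨k, hk⟩ := hr.exists_mul_lt (N + 1) hε'
    have := (almostInvariant_of_isEvenEuclid k b N r hr hN).mono hnN
    rw [h0, h1] at this
    exact ⟨_, (ENNReal.ofReal_le_ofReal hk.le).trans hle, this⟩
  have main' : ∀ (n : ℕ) (ε : ℝ≥0∞), ε ≠ 0 → ∃ δ ≤ ε, AlmostInvariant b x y n δ := by
    intro n ε hε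
    rcases lt_trichotomy x y with hxy | hxy | hxy
    · exact main b x y hx hxy h n ε hε
    · rw [hxy, div_self hy.ne'] at h
      exact absurd rfl h.ne_one
    · have h' : Irrational (x / y) := by
        rw [← inv_div]
        exact h.inv
      obtain ⟨δ, hδ, hA⟩ := main (!b) y x hy hxy h' n ε hε
      have := hA.swap hy hx
      rw [Bool.not_not] at this
      exact ⟨δ, hδ, this⟩
  refine conservative_of_almost_invariant (measurePreserving_step b hx hy) (fun n => {z | z.1 ≤ n})
    (ae_of_all _ fun z => ⟨z.1, le_refl z.1⟩) fun n ε hε => ?_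
  obtain ⟨δ, hδ, K, h1, h2, h3, h4⟩ := main' n ε hε
  exact ⟨K, h1, ae_of_all _ h2, h3, h4.trans hδ⟩

/-! ### Rays and trajectories on the surface -/

/-- The point of the surface represented by a point of a polygon, with a junk value outside. -/
noncomputable def point (b : Bool) (p : ℝ × ℝ) : S₁ :=
  open Classical in
  if h : p ∈ polygon b then proj b ⟨p, h⟩
  else proj true ⟨vertex 0, subset_convexHull ℝ _ ⟨0, rfl⟩⟩

theorem point_of_mem {b : Bool} {p : ℝ × ℝ} (h : p ∈ polygon b) : point b p = proj b ⟨p, h⟩ :=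
  dif_pos h

/-- A straight-line trajectory with velocity `v` that is defined for nonnegative times. -/
def IsRay (v : ℝ × ℝ) (γ : ℝ → S₁) : Prop :=
  ∀ t : ℝ, 0 ≤ t → γ t ∉ singularities ∧
    (∃ ε > (0 : ℝ), ∃ (b : Bool) (p : ℝ × ℝ), ∀ s ∈ Set.Icc t (t + ε),
      ∃ h : p + (s - t) • v ∈ polygon b, γ s = proj b ⟨p + (s - t) • v, h⟩) ∧
    (0 < t → ∃ ε > (0 : ℝ), ∃ (b : Bool) (p : ℝ × ℝ), ∀ s ∈ Set.Icc (t - ε) t,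
      ∃ h : p + (s - t) • v ∈ polygon b, γ s = proj b ⟨p + (s - t) • v, h⟩)

theorem IsRay.shift {v : ℝ × ℝ} {γ : ℝ → S₁} (h : IsRay v γ) {t₀ : ℝ} (ht₀ : 0 ≤ t₀) :
    IsRay v (fun t => γ (t₀ + t)) := by
  intro t ht
  obtain ⟨h1, ⟨ε, hε, b, p, h2⟩, h3⟩ := h (t₀ + t) (by linarith)
  refine ⟨h1, ⟨ε, hε, b, p, fun s hs => ?_⟩, fun htpos => ?_⟩
  · have := h2 (t₀ + s) ⟨by linarith [hs.1], by linarith [hs.2]⟩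
    rwa [show t₀ + s - (t₀ + t) = s - t by ring] at this
  · obtain ⟨ε', hε', b', p', h4⟩ := h3 (by linarith)
    refine ⟨ε', hε', b', p', fun s hs => ?_⟩
    have := h4 (t₀ + s) ⟨by linarith [hs.1], by linarith [hs.2]⟩
    rwa [show t₀ + s - (t₀ + t) = s - t by ring] at this

theorem IsRay.comp_mul {v : ℝ × ℝ} {γ : ℝ → S₁} (h : IsRay v γ) {a : ℝ} (ha : 0 < a) :
    IsRay (a • v) (fun t => γ (a * t)) := by
  intro t ht
  obtain ⟨h1, ⟨ε, hε, b, p, h2⟩, h3⟩ := h (a * t) (by positivity)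
  have e : ∀ s, (s - t) • a • v = (a * s - a * t) • v := fun s => by
    rw [smul_smul]; congr 1; ring
  refine ⟨h1, ⟨ε / a, by positivity, b, p, fun s hs => ?_⟩, fun htpos => ?_⟩
  · simp only [e]
    refine h2 (a * s) ⟨by nlinarith [hs.1], ?_⟩
    have := mul_le_mul_of_nonneg_left hs.2 ha.le
    rwa [mul_add, mul_div_cancel₀ _ ha.ne'] at this
  · obtain ⟨ε', hε', b', p', h4⟩ := h3 (by positivity)
    refine ⟨ε' / a, by positivity, b', p', fun s hs => ?_⟩
    simp only [e]
    refine h4 (a * s) ⟨?_, by nlinarith [hs.2]⟩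
    have := mul_le_mul_of_nonneg_left hs.1 ha.le
    rwa [mul_sub, mul_div_cancel₀ _ ha.ne'] at this

/-- Two opposite rays form a bi-infinite trajectory. -/
theorem isTrajectory_of_isRay {v : ℝ × ℝ} {γ₁ γ₂ : ℝ → S₁} (h₁ : IsRay v γ₁) (h₂ : IsRay (-v) γ₂)
    (h0 : γ₁ 0 = γ₂ 0) : IsTrajectory v (fun t => if 0 ≤ t then γ₁ t else γ₂ (-t)) := by
  have neg : ∀ s : ℝ, s ≤ 0 → (if 0 ≤ s then γ₁ s else γ₂ (-s)) = γ₂ (-s) := by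
    intro s hs
    split_ifs with h
    · rw [le_antisymm hs h, neg_zero, h0]
    · rfl
  have e : ∀ s t : ℝ, (-s - -t) • -v = (s - t) • v := fun s t => by
    rw [smul_neg, ← neg_smul]; congr 1; ring
  have right : ∀ t, (if 0 ≤ t then γ₁ t else γ₂ (-t)) ∉ singularities ∧ ∃ ε > (0 : ℝ),
      ∃ (b : Bool) (p : ℝ × ℝ), ∀ s ∈ Set.Icc t (t + ε),
        ∃ h : p + (s - t) • v ∈ polygon b,
          (if 0 ≤ s then γ₁ s else γ₂ (-s)) = proj b ⟨p + (s - t) • v, h⟩ := by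
    intro t
    rcases le_or_gt 0 t with ht | ht
    · obtain ⟨g1, ⟨ε, hε, b, p, g2⟩, -⟩ := h₁ t ht
      refine ⟨by rwa [if_pos ht], ε, hε, b, p, fun s hs => ?_⟩
      rw [if_pos (ht.trans hs.1)]
      exact g2 s hs
    · obtain ⟨g1, -, g3⟩ := h₂ (-t) (by linarith)
      obtain ⟨ε, hε, b, p, g2⟩ := g3 (by linarith)
      refine ⟨by rwa [if_neg (not_le.2 ht)], min ε (-t), lt_min hε (by linarith), b, p,
        fun s hs => ?_⟩
      have h3 := min_le_left ε (-t)
      have h4 := min_le_right ε (-t)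
      rw [neg s (by linarith [hs.2])]
      have := g2 (-s) ⟨by linarith [hs.2], by linarith [hs.1]⟩
      rwa [e] at this
  have left : ∀ t, ∃ ε > (0 : ℝ),
      ∃ (b : Bool) (p : ℝ × ℝ), ∀ s ∈ Set.Icc (t - ε) t,
        ∃ h : p + (s - t) • v ∈ polygon b,
          (if 0 ≤ s then γ₁ s else γ₂ (-s)) = proj b ⟨p + (s - t) • v, h⟩ := by
    intro t
    rcases lt_or_ge 0 t with ht | ht
    · obtain ⟨-, -, g3⟩ := h₁ t ht.le
      obtain ⟨ε, hε, b, p, g2⟩ := g3 ht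
      refine ⟨min ε t, lt_min hε ht, b, p, fun s hs => ?_⟩
      have h3 := min_le_left ε t
      have h4 := min_le_right ε t
      rw [if_pos (by linarith [hs.1])]
      exact g2 s ⟨by linarith [hs.1], hs.2⟩
    · obtain ⟨-, ⟨ε, hε, b, p, g2⟩, -⟩ := h₂ (-t) (by linarith)
      refine ⟨ε, hε, b, p, fun s hs => ?_⟩
      rw [neg s (by linarith [hs.2])]
      have := g2 (-s) ⟨by linarith [hs.2], by linarith [hs.1]⟩
      rwa [e] at this
  intro t
  obtain ⟨h1, ε, hε, b, p, h2⟩ := right t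
  obtain ⟨ε', hε', b', p', h3⟩ := left t
  refine ⟨h1, min ε ε', lt_min hε hε', ⟨b', p', fun s hs => h3 s ⟨?_, hs.2⟩⟩,
    ⟨b, p, fun s hs => h2 s ⟨hs.1, ?_⟩⟩⟩
  · linarith [hs.1, min_le_right ε ε']
  · linarith [hs.2, min_le_left ε ε']

/-- Segments in the polygons, each continued by the next one, form a ray. -/
theorem exists_isRay {v : ℝ × ℝ} (b : ℕ → Bool) (p : ℕ → ℝ × ℝ) (l : ℕ → ℝ) (hl : ∀ n, 0 < l n)
    (hdiv : Tendsto (fun n => ∑ i ∈ Finset.range n, l i) atTop atTop)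
    (hmem : ∀ n t, 0 ≤ t → t ≤ l n → p n + t • v ∈ polygon (b n))
    (hsing : ∀ n t, 0 ≤ t → t ≤ l n → point (b n) (p n + t • v) ∉ singularities)
    (hglue : ∀ n, point (b n) (p n + l n • v) = point (b (n + 1)) (p (n + 1))) :
    ∃ γ, IsRay v γ ∧ ∀ n t, 0 ≤ t → t ≤ l n →
      γ (∑ i ∈ Finset.range n, l i + t) = point (b n) (p n + t • v) := by
  set τ : ℕ → ℝ := fun n => ∑ i ∈ Finset.range n, l i with hτ
  have hτs : ∀ n, τ (n + 1) = τ n + l n := fun n => Finset.sum_range_succ _ _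
  have hτ0 : τ 0 = 0 := Finset.sum_range_zero _
  have hτm : StrictMono τ := strictMono_nat_of_lt_succ fun n => by rw [hτs]; linarith [hl n]
  have hex : ∀ t, ∃ n, t < τ (n + 1) := fun t =>
    ((hdiv.comp (tendsto_add_atTop_nat 1)).eventually_gt_atTop t).exists
  classical
  -- `N t` is the index of the segment in progress at time `t`; at a junction it is the later of the
  -- two.
  let N : ℝ → ℕ := fun t => Nat.find (hex t)
  have hN1 : ∀ t, t < τ (N t + 1) := fun t => Nat.find_spec (hex t)
  have hN2 : ∀ t, 0 ≤ t → τ (N t) ≤ t := by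
    intro t ht
    rcases Nat.eq_zero_or_pos (N t) with h | h
    · rw [h, hτ0]; exact ht
    · have := Nat.find_min (hex t) (Nat.sub_one_lt h.ne')
      rw [not_lt, Nat.sub_add_cancel h] at this
      exact this
  have hN3 : ∀ n t, τ n ≤ t → t < τ (n + 1) → N t = n := by
    intro n t h1 h2
    have h3 : τ n < τ (N t + 1) := h1.trans_lt (hN1 t)
    have h4 : N t ≤ n := Nat.find_min' (hex t) h2
    have h5 := hτm.lt_iff_lt.1 h3
    omega
  let γ : ℝ → S₁ := fun t => point (b (N t)) (p (N t) + (t - τ (N t)) • v)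
  have hγ : ∀ n t, 0 ≤ t → t ≤ l n → γ (τ n + t) = point (b n) (p n + t • v) := by
    intro n t h1 h2
    rcases lt_or_eq_of_le h2 with h | h
    · have : N (τ n + t) = n := hN3 n _ (by linarith) (by rw [hτs]; linarith)
      simp only [γ, this, add_sub_cancel_left]
    · have : N (τ n + t) = n + 1 := by
        refine hN3 (n + 1) _ (by rw [hτs]; linarith) (by rw [hτs, hτs]; linarith [hl (n + 1)])
      rw [h, hglue]
      simp only [γ]
      rw [← h, this, hτs, h]
      simp
  have piece : ∀ n t s, s ∈ Set.Icc (τ n) (τ (n + 1)) →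
      ∃ h : p n + (t - τ n) • v + (s - t) • v ∈ polygon (b n),
        γ s = proj (b n) ⟨p n + (t - τ n) • v + (s - t) • v, h⟩ := by
    intro n t s hs
    have e : p n + (t - τ n) • v + (s - t) • v = p n + (s - τ n) • v := by
      rw [add_assoc, ← add_smul]; congr 2; ring
    have h1 : 0 ≤ s - τ n := by linarith [hs.1]
    have h2 : s - τ n ≤ l n := by linarith [hs.2, hτs n]
    have h := hmem n _ h1 h2
    rw [e]
    refine ⟨h, ?_⟩
    rw [← point_of_mem h, ← hγ n _ h1 h2, add_sub_cancel]
  refine ⟨γ, fun t ht => ⟨?_, ⟨τ (N t + 1) - t, by linarith [hN1 t], b (N t), _, fun s hs =>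
    piece (N t) t s ⟨?_, ?_⟩⟩, fun htpos => ?_⟩, hγ⟩
  · have h1 : 0 ≤ t - τ (N t) := by linarith [hN2 t ht]
    have h2 : t - τ (N t) ≤ l (N t) := by linarith [hN1 t, hτs (N t)]
    exact hsing _ _ h1 h2
  · linarith [hN2 t ht, hs.1]
  · linarith [hs.2]
  · rcases lt_or_eq_of_le (hN2 t ht) with h | h
    · exact ⟨t - τ (N t), by linarith, b (N t), _, fun s hs =>
        piece (N t) t s ⟨by linarith [hs.1], by linarith [hs.2, hN1 t]⟩⟩
    -- At a junction time the motion just before `t` takes place in the previous segment.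
    · obtain ⟨m, hm⟩ : ∃ m, N t = m + 1 := by
        refine Nat.exists_eq_succ_of_ne_zero fun h0 => ?_
        rw [h0, hτ0] at h
        exact htpos.ne h
      rw [hm] at h
      exact ⟨l m, hl m, b m, _, fun s hs =>
        piece m t s ⟨by linarith [hs.1, hτs m], by linarith [hs.2]⟩⟩

/-! ### Edges, singularities and null sets -/

theorem vertex_mem_edge_iff {m n : ℤ} : vertex m ∈ edge n ↔ m = n ∨ m = n + 1 := by
  constructor
  · rintro ⟨a, c, ha, hc, hac, h⟩
    have h1 := congrArg Prod.fst h
    simp only [vertex, Prod.fst_add, Prod.smul_fst, smul_eq_mul, Int.cast_add, Int.cast_one] at h1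
    obtain rfl : a = 1 - c := by linarith
    have h2 : (n : ℝ) ≤ m := by linarith
    have h3 : (m : ℝ) ≤ n + 1 := by linarith
    have h2' : n ≤ m := by exact_mod_cast h2
    have h3' : m ≤ n + 1 := by exact_mod_cast h3
    omega
  · rintro (rfl | rfl)
    · exact left_mem_segment ℝ _ _
    · exact right_mem_segment ℝ _ _

/-- Each edge is invariant under the rotation about its midpoint. -/
theorem add_sub_mem_edge {n : ℤ} {p : ℝ × ℝ} (h : p ∈ edge n) :
    vertex n + vertex (n + 1) - p ∈ edge n := by
  obtain ⟨a, c, ha, hc, hac, rfl⟩ := h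
  refine ⟨c, a, hc, ha, by rw [add_comm, hac], ?_⟩
  have : a = 1 - c := by linarith
  subst this
  ext <;> simp <;> ring

/-- A point of a polygon that is not a vertex does not represent a singularity. -/
theorem proj_notMem_singularities {b : Bool} {p : polygon b}
    (h : ∀ n : ℤ, (p : ℝ × ℝ) ≠ if b then vertex n else -vertex n) :
    proj b p ∉ singularities := by
  let f : Pieces → Prop := fun x => ∃ n : ℤ, (x.2 : ℝ × ℝ) = if x.1 then vertex n else -vertex n
  have hf : ∀ x y, Glue x y → f x = f y := by
    rintro ⟨b, x⟩ ⟨b', y⟩ ⟨h1, h2, n, h3, h4⟩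
    simp only at h1 h2 h3 h4
    subst h1 h2
    -- The only vertices on an edge are its ends, and the gluing translation takes ends to ends. So
    -- being a vertex is invariant under the identifications and descends to the quotient.
    have key : ∀ k : ℤ, (k = n ∨ k = n + 1) →
        vertex k - (vertex n + vertex (n + 1)) = -vertex (n + (n + 1) - k) := by
      rintro k (rfl | rfl)
      · rw [show k + (k + 1) - k = k + 1 by ring]; abel
      · rw [show n + (n + 1) - (n + 1) = n by ring]; abel
    simp only [f, eq_iff_iff, if_true, Bool.false_eq_true, if_false, h4]
    constructor
    · rintro ⟨m, hm⟩
      rw [hm] at h3 ⊢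
      exact ⟨_, key m (vertex_mem_edge_iff.1 h3)⟩
    · rintro ⟨m, hm⟩
      have h5 : vertex n + vertex (n + 1) - (x : ℝ × ℝ) = vertex m := by
        rw [← neg_sub, hm, neg_neg]
      have h6 : (x : ℝ × ℝ) = vertex n + vertex (n + 1) - vertex m := by rw [← h5]; abel
      have h7 := add_sub_mem_edge h3
      rw [h5] at h7
      have h8 := key m (vertex_mem_edge_iff.1 h7)
      exact ⟨_, by rw [h6, ← neg_sub, h8, neg_neg]⟩
  rintro ⟨b', q, hq, n, hn⟩
  have h1 : f ⟨b, p⟩ = f ⟨b', q⟩ := congrArg (Quot.lift f hf) hq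
  have h2 : f ⟨b, p⟩ := h1 ▸ ⟨n, hn⟩
  obtain ⟨m, hm⟩ := h2
  exact h m hm

theorem volume_graph (f : ℝ → ℝ) (hf : Measurable f) : volume {p : ℝ × ℝ | p.2 = f p.1} = 0 := by
  have hm : MeasurableSet {p : ℝ × ℝ | p.2 = f p.1} :=
    measurableSet_eq_fun measurable_snd (hf.comp measurable_fst)
  rw [Measure.volume_eq_prod, Measure.measure_prod_null hm]
  refine ae_of_all _ fun x => ?_
  have : Prod.mk x ⁻¹' {p : ℝ × ℝ | p.2 = f p.1} = {f x} := by ext; simp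
  change volume (Prod.mk x ⁻¹' {p : ℝ × ℝ | p.2 = f p.1}) = 0
  rw [this]
  simp

theorem snd_of_mem_edge {n : ℤ} {p : ℝ × ℝ} (h : p ∈ edge n) :
    p.2 = (2 * n + 1) * p.1 - n * (n + 1) := by
  obtain ⟨a, c, ha, hc, hac, rfl⟩ := h
  have : a = 1 - c := by linarith
  subst this
  simp [vertex]
  ring

theorem volume_edge (n : ℤ) : volume (edge n) = 0 :=
  measure_mono_null (fun _ hp => snd_of_mem_edge hp)
    (volume_graph (fun x => (2 * n + 1) * x - n * (n + 1)) (by fun_prop))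

theorem measurableSet_edge (n : ℤ) : MeasurableSet (edge n) := by
  refine IsClosed.measurableSet (IsCompact.isClosed ?_)
  rw [edge, ← convexHull_pair (𝕜 := ℝ)]
  exact (Set.toFinite _).isCompact_convexHull ℝ

/-- A property that holds for almost all points of the polygons holds almost everywhere on the
surface. -/
theorem ae_area {P : S₁ → Prop}
    (h : ∀ b, ∀ᵐ p : ℝ × ℝ, ∀ hp : p ∈ polygon b, P (proj b ⟨p, hp⟩)) : ∀ᵐ x ∂area, P x := by
  -- `P` need not be measurable, so the exceptional sets are replaced by measurable hulls. Adding
  -- all edges, which are null, makes their union compatible with the identifications, so that it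
  -- comes from a measurable set of the surface.
  let N : Bool → Set (ℝ × ℝ) := fun b =>
    toMeasurable volume {p : ℝ × ℝ | ¬ ∀ hp : p ∈ polygon b, P (proj b ⟨p, hp⟩)}
  let E : Bool → Set (ℝ × ℝ) := fun b => if b then ⋃ n, edge n else Neg.neg ⁻¹' ⋃ n, edge n
  have hE : ∀ b, MeasurableSet (E b) ∧ volume (E b) = 0 := by
    have h1 : MeasurableSet (⋃ n, edge n) := MeasurableSet.iUnion measurableSet_edge
    have h2 : volume (⋃ n, edge n) = 0 := measure_iUnion_null volume_edge
    intro b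
    cases b
    · refine ⟨measurable_neg h1, ?_⟩
      exact ((Measure.measurePreserving_neg volume).measure_preimage h1.nullMeasurableSet).trans h2
    · exact ⟨h1, h2⟩
  let f : Pieces → Prop := fun x => (x.2 : ℝ × ℝ) ∈ N x.1 ∪ E x.1
  have hf : ∀ x y, Glue x y → f x = f y := by
    rintro ⟨b, x⟩ ⟨b', y⟩ ⟨h1, h2, n, h3, h4⟩
    simp only at h1 h2 h3 h4
    subst h1 h2
    have e1 : f ⟨true, x⟩ := Or.inr (Set.mem_iUnion.2 ⟨n, h3⟩)
    have e2 : f ⟨false, y⟩ := by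
      refine Or.inr (Set.mem_iUnion.2 ⟨n, ?_⟩)
      rw [h4, neg_sub]
      exact add_sub_mem_edge h3
    rw [eq_true e1, eq_true e2]
  let B : Set S₁ := {x | Quot.lift f hf x}
  have hpre : ∀ b, proj b ⁻¹' B = Subtype.val ⁻¹' (N b ∪ E b) := fun b => rfl
  have hB : MeasurableSet B := by
    refine MeasurableSpace.measurableSet_iInf.2 fun b => ?_
    change MeasurableSet ((Subtype.val : polygon b → ℝ × ℝ) ⁻¹' (N b ∪ E b))
    exact measurable_subtype_coe ((measurableSet_toMeasurable _ _).union (hE b).1)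
  have hB0 : area B = 0 := by
    rw [area_apply hB]
    refine Finset.sum_eq_zero fun b _ => ?_
    rw [hpre]
    refine measure_mono_null (Set.image_preimage_subset _ _) (measure_union_null ?_ (hE b).2)
    rw [measure_toMeasurable]
    exact h b
  refine measure_mono_null (fun x hx => ?_) hB0
  induction x using Quot.ind with
  | mk x =>
    obtain ⟨b, p⟩ := x
    refine Or.inl (subset_toMeasurable _ _ ?_)
    intro hcon
    exact hx (hcon p.2)

/-! ### Coding of chords by the staircase -/

/-- The edge of the upper polygon that is a diagonal of the `j`-th rectangle of the staircase. -/
def edgeIndex (j : ℕ) : ℤ := if j % 2 = 0 then ((j / 2 : ℕ) : ℤ) else -((j / 2 : ℕ) : ℤ) - 1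

/-- The polygon that is entered through the diagonal of the `j`-th rectangle. -/
def side (j : ℕ) : Bool := decide (j % 2 = 1)

/-- The sign of the rotation that carries the polygon `side j` to the upper one. -/
def sgn (j : ℕ) : ℝ := if j % 2 = 0 then -1 else 1

/-- The height of the line of slope `α` through the `n`-th vertex. -/
def vertexHeight (α : ℝ) (n : ℤ) : ℝ := (n : ℝ) ^ 2 - α * n

/-- The abscissa of the intersection of the line of slope `α` and height `i` with the `n`-th edge. -/
noncomputable def foot (α : ℝ) (n : ℤ) (i : ℝ) : ℝ := (i + n * (n + 1)) / (2 * n + 1 - α)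

/-- The height of the chord that starts at a point of the transversal, in the upper polygon or
after rotation to the upper polygon. -/
noncomputable def height (α : ℝ) (z : ℕ × ℝ) : ℝ :=
  (if z.1 % 2 = 0 then (((z.1 / 2 : ℕ) : ℝ) + 1) ^ 2 - α * (3 * ((z.1 / 2 : ℕ) : ℝ) + 1)
    else ((z.1 / 2 : ℕ) : ℝ) ^ 2 + α * (3 * ((z.1 / 2 : ℕ) : ℝ) + 2)) - sgn z.1 * z.2

/-- The starting point of the chord. -/
noncomputable def start (α : ℝ) (z : ℕ × ℝ) : ℝ × ℝ :=
  sgn z.1 • (foot α (edgeIndex z.1) (height α z),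
    α * foot α (edgeIndex z.1) (height α z) + height α z)

/-- The first return map of the flow with velocity `(1, α)` to the edges. -/
noncomputable def chordStep (α : ℝ) : ℕ × ℝ → ℕ × ℝ := step false (1 - α) α

/-- The duration of the passage along the chord. -/
noncomputable def duration (α : ℝ) (z : ℕ × ℝ) : ℝ :=
  sgn z.1 * (foot α (edgeIndex (chordStep α z).1) (height α z) -
    foot α (edgeIndex z.1) (height α z))

section Parity

variable (k : ℕ)

theorem two_mul_add_one_mod : (2 * k + 1) % 2 = 1 := by omega
theorem two_mul_add_one_div : (2 * k + 1) / 2 = k := by omega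

theorem edgeIndex_even : edgeIndex (2 * k) = k := by simp [edgeIndex]
theorem edgeIndex_odd : edgeIndex (2 * k + 1) = -k - 1 := by
  simp [edgeIndex, two_mul_add_one_mod, two_mul_add_one_div]
theorem side_even : side (2 * k) = false := by simp [side]
theorem side_odd : side (2 * k + 1) = true := by simp [side, two_mul_add_one_mod]
theorem sgn_even : sgn (2 * k) = -1 := by simp [sgn]
theorem sgn_odd : sgn (2 * k + 1) = 1 := by simp [sgn, two_mul_add_one_mod]
theorem len_false_even : len false (2 * k) = 2 * k + 1 := by simp [len]
theorem len_false_odd : len false (2 * k + 1) = 2 * k + 1 := by simp [len, two_mul_add_one_mod]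
theorem len_true_even : len true (2 * k) = 2 * k := by simp [len]
theorem len_true_odd : len true (2 * k + 1) = 2 * k + 2 := by
  simp [len, two_mul_add_one_mod]; ring
theorem nb_false_even : nb false (2 * k) = 2 * k + 1 := by simp [nb]
theorem nb_false_odd : nb false (2 * k + 1) = 2 * k := by simp [nb, two_mul_add_one_mod]
theorem nb_true_odd : nb true (2 * k + 1) = 2 * (k + 1) := by
  simp [nb, two_mul_add_one_mod]; ring
theorem nb_true_even_succ : nb true (2 * (k + 1)) = 2 * k + 1 := by simp [nb]; omega

theorem height_even (α c : ℝ) :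
    height α (2 * k, c) = ((k : ℝ) + 1) ^ 2 - α * (3 * k + 1) + c := by
  simp [height, sgn_even]
theorem height_odd (α c : ℝ) :
    height α (2 * k + 1, c) = (k : ℝ) ^ 2 + α * (3 * k + 2) - c := by
  simp [height, sgn_odd, two_mul_add_one_mod, two_mul_add_one_div]

end Parity

theorem sgn_mul_self (j : ℕ) : sgn j * sgn j = 1 := by
  unfold sgn; split_ifs <;> norm_num

/-- The possible passages from a chord to the next one. -/
theorem chordStep_cases {α : ℝ} {z : ℕ × ℝ} (hz : z ∈ strip false (1 - α) α) :
    (∃ (k : ℕ) (c : ℝ), z = (2 * k + 1, c) ∧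
      chordStep α z = (2 * k, c - (2 * k + 2) * α)) ∨
    (∃ (k : ℕ) (c : ℝ), z = (2 * k + 1, c) ∧
      chordStep α z = (2 * (k + 1), c + (2 * k + 1) * (1 - α))) ∨
    (∃ (k : ℕ) (c : ℝ), z = (2 * k, c) ∧ chordStep α z = (2 * k + 1, c - 2 * k * α)) ∨
    (∃ (k : ℕ) (c : ℝ), z = (2 * (k + 1), c) ∧
      chordStep α z = (2 * k + 1, c + (2 * k + 3) * (1 - α))) := by
  obtain ⟨j, c⟩ := z
  obtain ⟨h1, h2⟩ := hz
  simp only [Bool.not_false] at h1 h2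
  rcases lt_or_ge (len true j * α - len false j * (1 - α)) c with h | h
  · have hs : chordStep α (j, c) = _ := step_of_lt h
    rcases Nat.even_or_odd' j with ⟨k, rfl | rfl⟩
    · right; right; left
      refine ⟨k, c, rfl, ?_⟩
      rw [hs, nb_false_even, Bool.not_false, len_true_even]
    · left
      refine ⟨k, c, rfl, ?_⟩
      rw [hs, nb_false_odd, Bool.not_false, len_true_odd]
  · have hs : chordStep α (j, c) = _ := step_of_le h
    rcases Nat.even_or_odd' j with ⟨k, rfl | rfl⟩
    · rcases k with _ | k
      -- Rectangle `0` has width zero, so no orbit leaves it upwards.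
      · simp [len] at h h1
        linarith
      · right; right; right
        refine ⟨k, c, rfl, ?_⟩
        rw [hs, Bool.not_false, nb_true_even_succ, len_false_even]
        push_cast
        ring_nf
    · right; left
      refine ⟨k, c, rfl, ?_⟩
      rw [hs, Bool.not_false, nb_true_odd, len_false_odd]

theorem side_chordStep {α : ℝ} {z : ℕ × ℝ} (hz : z ∈ strip false (1 - α) α) :
    side (chordStep α z).1 = !side z.1 := by
  rcases chordStep_cases hz with ⟨k, c, rfl, h⟩ | ⟨k, c, rfl, h⟩ | ⟨k, c, rfl, h⟩ | ⟨k, c, rfl, h⟩ <;>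
    rw [h] <;> simp only [side_even, side_odd, Bool.not_true, Bool.not_false]

theorem sgn_eq (j : ℕ) : sgn j = if side j then 1 else -1 := by
  rcases Nat.even_or_odd' j with ⟨k, rfl | rfl⟩
  · simp [sgn_even, side_even]
  · simp [sgn_odd, side_odd]

/-- With both polygons rotated to the upper one, the gluing of an edge becomes the half-turn about
its midpoint, which sends a line of height `i` to height (sum of the heights of the ends) `- i`.
This identity shows that `step` describes the flow on the surface. -/
theorem height_chordStep {α : ℝ} {z : ℕ × ℝ} (hz : z ∈ strip false (1 - α) α) :
    height α (chordStep α z) = vertexHeight α (edgeIndex (chordStep α z).1) +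
      vertexHeight α (edgeIndex (chordStep α z).1 + 1) - height α z := by
  rcases chordStep_cases hz with ⟨k, c, rfl, h⟩ | ⟨k, c, rfl, h⟩ | ⟨k, c, rfl, h⟩ | ⟨k, c, rfl, h⟩ <;>
    rw [h] <;> simp only [height_even, height_odd, edgeIndex_even, edgeIndex_odd, vertexHeight] <;>
    push_cast <;> ring

/-- The constants in `height` are chosen so that the ends of the transversal interval have the
heights of the two ends of the edge. -/
theorem height_mem_uIcc {α : ℝ} {z : ℕ × ℝ} (hz : z ∈ strip false (1 - α) α) :
    height α z ∈ Set.uIcc (vertexHeight α (edgeIndex z.1)) (vertexHeight α (edgeIndex z.1 + 1)) := by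
  obtain ⟨j, c⟩ := z
  obtain ⟨h1, h2⟩ := hz
  simp only [Bool.not_false] at h1 h2
  rw [Set.mem_uIcc]
  rcases Nat.even_or_odd' j with ⟨k, rfl | rfl⟩
  · rw [len_false_even] at h1
    rw [len_true_even] at h2
    simp only [height_even, edgeIndex_even, vertexHeight]
    left
    push_cast
    constructor <;> nlinarith
  · rw [len_false_odd] at h1
    rw [len_true_odd] at h2
    simp only [height_odd, edgeIndex_odd, vertexHeight]
    right
    push_cast
    constructor <;> nlinarith

/-- Every height between those of the ends of an edge is the height of a chord. -/
theorem exists_height_eq {α : ℝ} {j : ℕ} {i : ℝ}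
    (hi : i ∈ Set.uIoo (vertexHeight α (edgeIndex j)) (vertexHeight α (edgeIndex j + 1)))
    (h0 : 0 < α) (h1 : α < 1) :
    ∃ c, (j, c) ∈ strip false (1 - α) α ∧ height α (j, c) = i := by
  rcases Nat.even_or_odd' j with ⟨k, rfl | rfl⟩
  · have hk : (0 : ℝ) ≤ k := by positivity
    rw [edgeIndex_even, Set.uIoo_of_le (by simp only [vertexHeight]; push_cast; nlinarith)] at hi
    simp only [vertexHeight, Set.mem_Ioo] at hi
    push_cast at hi
    refine ⟨i - (((k : ℝ) + 1) ^ 2 - α * (3 * k + 1)), ⟨?_, ?_⟩, by rw [height_even]; ring⟩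
    · rw [len_false_even]; simp only; nlinarith
    · rw [Bool.not_false, len_true_even]; simp only; nlinarith
  · have hk : (0 : ℝ) ≤ k := by positivity
    rw [edgeIndex_odd, Set.uIoo_of_ge (by simp only [vertexHeight]; push_cast; nlinarith)] at hi
    simp only [vertexHeight, Set.mem_Ioo] at hi
    push_cast at hi
    refine ⟨(k : ℝ) ^ 2 + α * (3 * k + 2) - i, ⟨?_, ?_⟩, by rw [height_odd]; ring⟩
    · rw [len_false_odd]; simp only; nlinarith
    · rw [Bool.not_false, len_true_odd]; simp only; nlinarith

theorem vertexHeight_succ_sub (α : ℝ) (n : ℤ) :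
    vertexHeight α (n + 1) - vertexHeight α n = 2 * n + 1 - α := by
  simp only [vertexHeight]; push_cast; ring

theorem edgeSlope_sub_pos {α : ℝ} (h1 : α < 1) {n : ℤ} (hn : 0 ≤ n) : 0 < 2 * (n : ℝ) + 1 - α := by
  have : (0 : ℝ) ≤ n := by exact_mod_cast hn
  linarith

theorem edgeSlope_sub_neg {α : ℝ} (h0 : 0 < α) {n : ℤ} (hn : n < 0) :
    2 * (n : ℝ) + 1 - α < 0 := by
  have : (n : ℝ) ≤ -1 := by exact_mod_cast (show n ≤ -1 by omega)
  linarith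

theorem edgeSlope_sub_ne_zero {α : ℝ} (h0 : 0 < α) (h1 : α < 1) (n : ℤ) :
    2 * (n : ℝ) + 1 - α ≠ 0 := by
  rcases lt_or_ge n 0 with h | h
  · exact (edgeSlope_sub_neg h0 h).ne
  · exact (edgeSlope_sub_pos h1 h).ne'

theorem foot_sub_mul {α : ℝ} (h0 : 0 < α) (h1 : α < 1) (n : ℤ) (i : ℝ) :
    (foot α n i - n) * (2 * n + 1 - α) = i - vertexHeight α n := by
  rw [foot, sub_mul, div_mul_cancel₀ _ (edgeSlope_sub_ne_zero h0 h1 n), vertexHeight]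
  ring

theorem foot_mem {α : ℝ} (h0 : 0 < α) (h1 : α < 1) {n : ℤ} {i : ℝ}
    (hi : i ∈ Set.uIcc (vertexHeight α n) (vertexHeight α (n + 1))) :
    (n : ℝ) ≤ foot α n i ∧ foot α n i ≤ n + 1 := by
  have h2 := foot_sub_mul h0 h1 n i
  have h3 := vertexHeight_succ_sub α n
  rcases lt_or_ge n 0 with h | h
  · have h4 := edgeSlope_sub_neg h0 h
    rw [Set.uIcc_of_ge (by linarith)] at hi
    obtain ⟨h5, h6⟩ := hi
    constructor <;> nlinarith
  · have h4 := edgeSlope_sub_pos h1 h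
    rw [Set.uIcc_of_le (by linarith)] at hi
    obtain ⟨h5, h6⟩ := hi
    constructor <;> nlinarith

theorem foot_ne {α : ℝ} (h0 : 0 < α) (h1 : α < 1) {n : ℤ} {i : ℝ}
    (hi : i ≠ vertexHeight α n) (hi' : i ≠ vertexHeight α (n + 1)) :
    foot α n i ≠ n ∧ foot α n i ≠ n + 1 := by
  have h2 := foot_sub_mul h0 h1 n i
  have h3 := vertexHeight_succ_sub α n
  constructor <;> intro h <;> rw [h] at h2
  · apply hi; linarith
  · apply hi'; linarith

/-- The point of the `n`-th edge on the line of height `i`. -/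
theorem foot_mem_edge {α : ℝ} (h0 : 0 < α) (h1 : α < 1) {n : ℤ} {i : ℝ}
    (hi : i ∈ Set.uIcc (vertexHeight α n) (vertexHeight α (n + 1))) :
    (foot α n i, α * foot α n i + i) ∈ edge n := by
  obtain ⟨h2, h3⟩ := foot_mem h0 h1 hi
  have h4 := foot_sub_mul h0 h1 n i
  refine ⟨n + 1 - foot α n i, foot α n i - n, by linarith, by linarith, by ring, ?_⟩
  simp only [vertexHeight] at h4
  ext
  · simp [vertex]; ring
  · simp [vertex]; linear_combination h4

theorem foot_add_foot {α : ℝ} (h0 : 0 < α) (h1 : α < 1) (n : ℤ) (i : ℝ) :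
    foot α n (vertexHeight α n + vertexHeight α (n + 1) - i) = 2 * n + 1 - foot α n i := by
  have h2 := edgeSlope_sub_ne_zero h0 h1 n
  rw [foot, foot, eq_sub_iff_add_eq, ← add_div, div_eq_iff h2]
  simp only [vertexHeight]
  push_cast
  ring

/-! ### Chords of the polygons -/

theorem edge_subset_upperPolygon (n : ℤ) : edge n ⊆ upperPolygon :=
  (convex_convexHull ℝ _).segment_subset (subset_convexHull ℝ _ ⟨n, rfl⟩)
    (subset_convexHull ℝ _ ⟨n + 1, rfl⟩)

theorem le_of_mem_upperPolygon {p : ℝ × ℝ} (hp : p ∈ upperPolygon) (a i : ℝ)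
    (h : ∀ n : ℤ, i ≤ (vertex n).2 - a * (vertex n).1) : i ≤ p.2 - a * p.1 := by
  have hconv : Convex ℝ {p : ℝ × ℝ | i ≤ p.2 - a * p.1} := by
    intro p hp q hq c d hc hd hcd
    simp only [Set.mem_ofPred_eq, Prod.snd_add, Prod.smul_snd, Prod.fst_add, Prod.smul_fst,
      smul_eq_mul] at hp hq ⊢
    have h3 : i = c * i + d * i := by rw [← add_mul, hcd, one_mul]
    rw [h3]
    nlinarith [mul_le_mul_of_nonneg_left hp hc, mul_le_mul_of_nonneg_left hq hd]
  exact convexHull_min (by rintro _ ⟨n, rfl⟩; exact h n) hconv hp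

/-- The upper polygon is above the lines through its edges. -/
theorem edge_line_le {p : ℝ × ℝ} (hp : p ∈ upperPolygon) (n : ℤ) :
    (2 * n + 1) * p.1 - n * (n + 1) ≤ p.2 := by
  have := le_of_mem_upperPolygon hp (2 * n + 1) (-(n * (n + 1))) fun m => by
    have h1 : (0 : ℤ) ≤ (m - n) * (m - n - 1) := by
      rcases lt_or_ge n m with h | h
      · exact mul_nonneg (by omega) (by omega)
      · exact mul_nonneg_of_nonpos_of_nonpos (by omega) (by omega)
    have h2 : (0 : ℝ) ≤ (m - n) * (m - n - 1) := by exact_mod_cast h1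
    simp only [vertex]
    nlinarith
  linarith

theorem mem_polygon_side {j : ℕ} {p : ℝ × ℝ} : p ∈ polygon (side j) ↔ sgn j • p ∈ upperPolygon := by
  rw [sgn_eq]
  cases side j <;> simp [polygon]

section Chord

variable {α : ℝ} {z : ℕ × ℝ}

theorem mapsTo_chordStep (h0 : 0 < α) (h1 : α < 1) :
    Set.MapsTo (chordStep α) (strip false (1 - α) α) (strip false (1 - α) α) :=
  mapsTo_step false (by linarith) h0

theorem start_add (t : ℝ) :
    start α z + t • ((1, α) : ℝ × ℝ) =
      sgn z.1 • (foot α (edgeIndex z.1) (height α z) + sgn z.1 * t,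
        α * (foot α (edgeIndex z.1) (height α z) + sgn z.1 * t) + height α z) := by
  have h := sgn_mul_self z.1
  ext
  · simp [start]; linear_combination (-t) * h
  · simp [start]; linear_combination (-t * α) * h

theorem height_mem_uIcc_next (h0 : 0 < α) (h1 : α < 1) (hz : z ∈ strip false (1 - α) α) :
    height α z ∈ Set.uIcc (vertexHeight α (edgeIndex (chordStep α z).1))
      (vertexHeight α (edgeIndex (chordStep α z).1 + 1)) := by
  have h2 := height_mem_uIcc (mapsTo_chordStep h0 h1 hz)
  rw [height_chordStep hz] at h2
  rw [Set.mem_uIcc] at h2 ⊢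
  rcases h2 with ⟨h3, h4⟩ | ⟨h3, h4⟩
  · left; constructor <;> linarith
  · right; constructor <;> linarith

theorem foot_add_sgn_mem {t : ℝ} (ht0 : 0 ≤ t) (ht : t ≤ duration α z) :
    foot α (edgeIndex z.1) (height α z) + sgn z.1 * t ∈
      Set.uIcc (foot α (edgeIndex z.1) (height α z))
        (foot α (edgeIndex (chordStep α z).1) (height α z)) := by
  rw [duration] at ht
  rw [Set.mem_uIcc]
  unfold sgn at ht ⊢
  split_ifs at ht ⊢
  · right; constructor <;> linarith
  · left; constructor <;> linarith

theorem chord_mem (h0 : 0 < α) (h1 : α < 1) (hz : z ∈ strip false (1 - α) α) {t : ℝ}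
    (ht0 : 0 ≤ t) (ht : t ≤ duration α z) :
    start α z + t • ((1, α) : ℝ × ℝ) ∈ polygon (side z.1) := by
  rw [mem_polygon_side, start_add, smul_smul, sgn_mul_self, one_smul]
  have hS : Convex ℝ {s : ℝ | (s, α * s + height α z) ∈ upperPolygon} := by
    intro s hs s' hs' a b ha hb hab
    have h := convex_convexHull ℝ (Set.range vertex) hs hs' ha hb hab
    have e : a • ((s, α * s + height α z) : ℝ × ℝ) + b • ((s', α * s' + height α z) : ℝ × ℝ) =
        (a • s + b • s', α * (a • s + b • s') + height α z) := by
      ext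
      · simp
      · simp; linear_combination height α z * hab
    rw [e] at h
    exact h
  exact hS.ordConnected.uIcc_subset
    (edge_subset_upperPolygon _ (foot_mem_edge h0 h1 (height_mem_uIcc hz)))
    (edge_subset_upperPolygon _ (foot_mem_edge h0 h1 (height_mem_uIcc_next h0 h1 hz)))
    (foot_add_sgn_mem ht0 ht)

/-- A chord whose height is not that of a vertex contains no vertex. -/
theorem point_chord_notMem_singularities (h0 : 0 < α) (h1 : α < 1)
    (hz : z ∈ strip false (1 - α) α) (hgood : ∀ m, height α z ≠ vertexHeight α m) {t : ℝ}
    (ht0 : 0 ≤ t) (ht : t ≤ duration α z) :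
    point (side z.1) (start α z + t • ((1, α) : ℝ × ℝ)) ∉ singularities := by
  rw [point_of_mem (chord_mem h0 h1 hz ht0 ht)]
  refine proj_notMem_singularities fun n hn => hgood n ?_
  have h2 : sgn z.1 • (start α z + t • ((1, α) : ℝ × ℝ)) = vertex n := by
    simp only at hn
    rw [hn, sgn_eq]
    cases side z.1 <;> simp
  rw [start_add, smul_smul, sgn_mul_self, one_smul] at h2
  have h3 := congrArg Prod.fst h2
  have h4 := congrArg Prod.snd h2
  simp only [vertex] at h3 h4
  rw [h3] at h4
  simp only [vertexHeight]
  linarith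

theorem edgeIndex_neg_iff {j : ℕ} : edgeIndex j < 0 ↔ side j = true := by
  rcases Nat.even_or_odd' j with ⟨k, rfl | rfl⟩
  · simp [edgeIndex_even, side_even]
  · simp [edgeIndex_odd, side_odd]; omega

/-- Edges of negative index lie over nonpositive abscissas and the others over nonnegative ones. A
chord joins one kind to the other, in the order given by `sgn`, and `hgood` keeps its start off the
vertices. -/
theorem duration_pos (h0 : 0 < α) (h1 : α < 1)
    (hz : z ∈ strip false (1 - α) α) (hgood : ∀ m, height α z ≠ vertexHeight α m) :
    0 < duration α z := by
  obtain ⟨a1, a2⟩ := foot_mem h0 h1 (height_mem_uIcc hz)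
  obtain ⟨b1, b2⟩ := foot_mem h0 h1 (height_mem_uIcc_next h0 h1 hz)
  obtain ⟨c1, c2⟩ := foot_ne h0 h1 (hgood (edgeIndex z.1)) (hgood _)
  have hs := side_chordStep hz
  rw [duration, sgn_eq]
  have key : ∀ n : ℤ, (0 ≤ n → (0 : ℝ) ≤ n) ∧ (n < 0 → (n : ℝ) + 1 ≤ 0) := fun n =>
    ⟨fun h => by exact_mod_cast h, fun h => by exact_mod_cast (show n + 1 ≤ 0 by omega)⟩
  by_cases h : side z.1 = true
  · have d1 := edgeIndex_neg_iff.2 h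
    have d2 : ¬ edgeIndex (chordStep α z).1 < 0 := by
      rw [edgeIndex_neg_iff, hs, h]; simp
    have e1 := (key _).2 d1
    have e2 := (key _).1 (not_lt.1 d2)
    have e3 := lt_of_le_of_ne a2 c2
    rw [if_pos h]
    linarith
  · have d1 : ¬ edgeIndex z.1 < 0 := by rwa [edgeIndex_neg_iff]
    have d2 : edgeIndex (chordStep α z).1 < 0 := by
      rw [edgeIndex_neg_iff, hs]; simpa using h
    have e1 := (key _).1 (not_lt.1 d1)
    have e2 := (key _).2 d2
    have e3 := lt_of_le_of_ne a1 c1.symm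
    rw [if_neg h]
    linarith

/-- The end of a chord is glued to the start of the next one. -/
theorem point_chord_end (h0 : 0 < α) (h1 : α < 1) (hz : z ∈ strip false (1 - α) α)
    (hd : 0 ≤ duration α z) (hd' : 0 ≤ duration α (chordStep α z)) :
    point (side z.1) (start α z + duration α z • ((1, α) : ℝ × ℝ)) =
      point (side (chordStep α z).1) (start α (chordStep α z)) := by
  have hm := chord_mem h0 h1 hz hd le_rfl
  have hm' := chord_mem h0 h1 (mapsTo_chordStep h0 h1 hz) le_rfl hd'
  rw [zero_smul, add_zero] at hm'
  obtain ⟨n, hn⟩ : ∃ n, n = edgeIndex (chordStep α z).1 := ⟨_, rfl⟩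
  obtain ⟨q, hq⟩ : ∃ q : ℝ × ℝ, q = (foot α n (height α z), α * foot α n (height α z) + height α z) :=
    ⟨_, rfl⟩
  have hqe : q ∈ edge n := by
    rw [hq, hn]
    exact foot_mem_edge h0 h1 (height_mem_uIcc_next h0 h1 hz)
  have hsgn : sgn (chordStep α z).1 = -sgn z.1 := by
    rw [sgn_eq, sgn_eq, side_chordStep hz]
    cases side z.1 <;> simp
  have e1 : start α z + duration α z • ((1, α) : ℝ × ℝ) = sgn z.1 • q := by
    rw [start_add, duration, ← mul_assoc, sgn_mul_self, one_mul, add_sub_cancel, hq, hn]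
  have e2 : start α (chordStep α z) = -(sgn z.1 • (vertex n + vertex (n + 1) - q)) := by
    rw [start, hsgn, height_chordStep hz, ← hn, foot_add_foot h0 h1, hq, neg_smul]
    congr 2
    ext
    · simp [vertex]; ring
    · simp [vertex, vertexHeight]; ring
  rw [e1] at hm ⊢
  rw [e2] at hm' ⊢
  rw [side_chordStep hz] at hm' ⊢
  rw [sgn_eq] at hm hm' ⊢
  rw [point_of_mem hm, point_of_mem hm']
  have hb : ∀ b : Bool, ∀ (s s' : ℝ × ℝ) (h : s ∈ polygon b) (h' : s' ∈ polygon (!b)),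
      s = (if b then (1 : ℝ) else -1) • q →
      s' = -((if b then (1 : ℝ) else -1) • (vertex n + vertex (n + 1) - q)) →
      proj b ⟨s, h⟩ = proj (!b) ⟨s', h'⟩ := by
    intro b s s' h h' hs hs'
    cases b
    · simp only [Bool.false_eq_true, if_false, neg_smul, one_smul, neg_neg] at hs hs'
      refine (Quot.sound ⟨rfl, rfl, n, ?_, ?_⟩).symm
      · simp only [hs']; exact add_sub_mem_edge hqe
      · simp only [hs', hs]; abel
    · simp only [if_true, one_smul] at hs hs'
      refine Quot.sound ⟨rfl, rfl, n, ?_, ?_⟩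
      · simp only [hs]; exact hqe
      · simp only [hs', hs]; abel
  exact hb (side z.1) _ _ hm hm' rfl rfl

/-- Every point of a polygon whose line of slope `α` contains no vertex is on a chord. -/
theorem exists_chord (h0 : 0 < α) (h1 : α < 1) {b : Bool} {p : ℝ × ℝ} (hp : p ∈ polygon b)
    (hgood : ∀ m, (if b then (1 : ℝ) else -1) * (p.2 - α * p.1) ≠ vertexHeight α m) :
    ∃ z ∈ strip false (1 - α) α, side z.1 = b ∧ ∃ t, 0 ≤ t ∧ t ≤ duration α z ∧
      p = start α z + t • ((1, α) : ℝ × ℝ) := by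
  obtain ⟨q, hq, hqp, hqi⟩ : ∃ q ∈ upperPolygon, p = (if b then (1 : ℝ) else -1) • q ∧
      q.2 - α * q.1 = (if b then (1 : ℝ) else -1) * (p.2 - α * p.1) := by
    cases b
    · exact ⟨-p, by simpa [polygon] using hp, by simp, by simp; ring⟩
    · exact ⟨p, by simpa [polygon] using hp, by simp, by simp⟩
  rw [← hqi] at hgood
  obtain ⟨i, hi⟩ : ∃ i, i = q.2 - α * q.1 := ⟨_, rfl⟩
  rw [← hi] at hgood
  -- For `0 < α < 1` the vertex heights `n ^ 2 - α * n` are nonnegative and the least is that of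
  -- vertex `0`. So `i` lies between the heights of consecutive vertices on each of the two
  -- branches.
  have hi0 : 0 < i := by
    have h2 := le_of_mem_upperPolygon hq α 0 fun n => by
      simp only [vertex]
      rcases lt_or_ge 0 n with h | h
      · have : (1 : ℝ) ≤ n := by exact_mod_cast h
        nlinarith
      · have : (n : ℝ) ≤ 0 := by exact_mod_cast h
        nlinarith
    rw [← hi] at h2
    refine lt_of_le_of_ne h2 fun h => hgood 0 ?_
    simp [vertexHeight, ← h]
  have hfind : ∀ B : ℕ → ℝ, B 0 ≤ 0 → (∃ k, i < B k) → (∀ k, i ≠ B k) →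
      ∃ k, B k < i ∧ i < B (k + 1) := by
    classical
    intro B hB0 hex hne
    obtain ⟨m, hm⟩ : ∃ m, Nat.find hex = m + 1 := by
      refine Nat.exists_eq_succ_of_ne_zero fun h => ?_
      have := Nat.find_spec hex
      rw [h] at this
      linarith
    refine ⟨m, ?_, hm ▸ Nat.find_spec hex⟩
    have := Nat.find_min hex (show m < Nat.find hex by omega)
    exact lt_of_le_of_ne (not_lt.1 this) (hne m).symm
  obtain ⟨j, hj, hij⟩ : ∃ j, side j = b ∧
      i ∈ Set.uIoo (vertexHeight α (edgeIndex j)) (vertexHeight α (edgeIndex j + 1)) := by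
    cases b
    · obtain ⟨k, hk1, hk2⟩ := hfind (fun k => vertexHeight α k) (by simp [vertexHeight]) (by
        obtain ⟨k, hk⟩ := exists_nat_gt (i + 1)
        refine ⟨k, ?_⟩
        simp only [vertexHeight, Int.cast_natCast]
        nlinarith) (fun k => hgood k)
      refine ⟨2 * k, side_even k, ?_⟩
      rw [edgeIndex_even, Set.uIoo_of_le (by push_cast at hk2; linarith)]
      push_cast at hk2
      exact ⟨hk1, hk2⟩
    · obtain ⟨k, hk1, hk2⟩ := hfind (fun k => vertexHeight α (-k)) (by simp [vertexHeight]) (by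
        obtain ⟨k, hk⟩ := exists_nat_gt (i + 1)
        refine ⟨k, ?_⟩
        simp only [vertexHeight, Int.cast_neg, Int.cast_natCast]
        nlinarith) (fun k => hgood (-k))
      refine ⟨2 * k + 1, side_odd k, ?_⟩
      have e1 : -(k : ℤ) - 1 + 1 = -k := by ring
      have e2 : -((k + 1 : ℕ) : ℤ) = -(k : ℤ) - 1 := by push_cast; ring
      simp only [e2] at hk2
      rw [edgeIndex_odd, e1, Set.uIoo_of_ge (by linarith)]
      exact ⟨hk1, hk2⟩
  obtain ⟨c, hc, hci⟩ := exists_height_eq hij h0 h1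
  have hsgn : sgn j = if b then 1 else -1 := by rw [sgn_eq, hj]
  rw [← hsgn] at hqp
  -- The point is above the line of each edge, so on its line of slope `α` it lies to the right of
  -- the feet on the left branch and to the left of those on the right branch.
  have hle : ∀ n : ℤ, (q.1 - foot α n i) * (2 * n + 1 - α) ≤ 0 := by
    intro n
    have h2 := edge_line_le hq n
    have h3 := foot_sub_mul h0 h1 n i
    simp only [vertexHeight] at h3
    nlinarith
  have hle1 : ∀ n : ℤ, n < 0 → foot α n i ≤ q.1 := fun n hn => by
    have := edgeSlope_sub_neg h0 hn
    nlinarith [hle n]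
  have hle2 : ∀ n : ℤ, ¬ n < 0 → q.1 ≤ foot α n i := fun n hn => by
    have := edgeSlope_sub_pos h1 (not_lt.1 hn)
    nlinarith [hle n]
  refine ⟨(j, c), hc, hj, sgn j * (q.1 - foot α (edgeIndex j) i), ?_, ?_, ?_⟩
  · rw [hsgn]
    cases b
    · have := hle2 (edgeIndex j) (by rw [edgeIndex_neg_iff, hj]; simp)
      simp only [Bool.false_eq_true, if_false]
      linarith
    · have := hle1 (edgeIndex j) (by rw [edgeIndex_neg_iff, hj])
      simp only [if_true]
      linarith
  · have hs := side_chordStep hc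
    simp only [hj] at hs
    rw [duration, hci]
    simp only
    rw [hsgn]
    cases b
    · have := hle1 (edgeIndex (chordStep α (j, c)).1) (by rw [edgeIndex_neg_iff, hs]; simp)
      simp only [Bool.false_eq_true, if_false]
      linarith
    · have := hle2 (edgeIndex (chordStep α (j, c)).1) (by rw [edgeIndex_neg_iff, hs]; simp)
      simp only [if_true]
      linarith
  · rw [start_add, hci, hqp]
    simp only
    rw [← mul_assoc, sgn_mul_self, one_mul, add_sub_cancel, hi, add_sub_cancel]

end Chord

/-! ### Recurrence for slopes in `(0, 1)` -/

/-- The trajectories of almost all points of every measurable set return to the set at arbitrarily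
large times. -/
def IsForwardRecurrent (v : ℝ × ℝ) : Prop :=
  ∀ A : Set S₁, MeasurableSet A → ∀ b, ∀ᵐ p : ℝ × ℝ, ∀ hp : p ∈ polygon b, proj b ⟨p, hp⟩ ∈ A →
    ∃ γ : ℝ → S₁, IsRay v γ ∧ γ 0 = proj b ⟨p, hp⟩ ∧ ∃ᶠ t in atTop, γ t ∈ A

theorem measurable_comp_fst {β : Type*} [MeasurableSpace β] (f : ℕ → β) :
    Measurable (fun z : ℕ × ℝ => f z.1) :=
  (measurable_of_countable f).comp measurable_fst

theorem measurable_height (α : ℝ) : Measurable (height α) :=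
  (measurable_comp_fst fun j : ℕ => if j % 2 = 0 then (((j / 2 : ℕ) : ℝ) + 1) ^ 2 -
      α * (3 * ((j / 2 : ℕ) : ℝ) + 1)
    else ((j / 2 : ℕ) : ℝ) ^ 2 + α * (3 * ((j / 2 : ℕ) : ℝ) + 2)).sub
    ((measurable_comp_fst sgn).mul measurable_snd)

theorem measurable_chordStep (α : ℝ) : Measurable (chordStep α) := measurable_step _ _ _

theorem measurable_foot {α : ℝ} {f : ℕ × ℝ → ℕ} (hf : Measurable f) :
    Measurable (fun z => foot α (edgeIndex (f z)) (height α z)) := by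
  have hn : Measurable fun z => ((edgeIndex (f z) : ℤ) : ℝ) :=
    (measurable_of_countable fun j : ℕ => ((edgeIndex j : ℤ) : ℝ)).comp hf
  exact ((measurable_height α).add (hn.mul (hn.add_const 1))).div
    (((hn.const_mul 2).add_const 1).sub_const α)

theorem measurable_duration (α : ℝ) : Measurable (duration α) :=
  (measurable_comp_fst sgn).mul
    ((measurable_foot (measurable_fst.comp (measurable_chordStep α))).sub
      (measurable_foot measurable_fst))

theorem measurable_start (α : ℝ) : Measurable (start α) :=
  (measurable_comp_fst sgn).smul ((measurable_foot measurable_fst).prodMk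
    (((measurable_foot measurable_fst).const_mul α).add (measurable_height α)))

theorem conservative_chordStep {α : ℝ} (h0 : 0 < α) (h1 : α < 1) (hα : Irrational α) :
    Conservative (chordStep α) (flux false (1 - α) α) := by
  refine conservative_step false (by linarith) h0 ?_
  have h2 : Irrational (α⁻¹ - (1 : ℤ)) := hα.inv.sub_intCast 1
  have h3 : α / (1 - α) = (α⁻¹ - (1 : ℤ))⁻¹ := by
    have : 1 - α ≠ 0 := by linarith
    have h4 : α⁻¹ - (1 : ℤ) = (1 - α) / α := by push_cast; field_simp
    rw [h4, inv_div]
  rw [h3]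
  exact h2.inv

theorem ae_height_ne {α : ℝ} (h0 : 0 < α) (h1 : α < 1) :
    ∀ᵐ z ∂flux false (1 - α) α, ∀ n : ℕ, ∀ m, height α ((chordStep α)^[n] z) ≠ vertexHeight α m := by
  have hT : MeasurePreserving (chordStep α) (flux false (1 - α) α) (flux false (1 - α) α) :=
    measurePreserving_step false (by linarith) h0
  have key : ∀ m, ∀ᵐ z ∂flux false (1 - α) α, height α z ≠ vertexHeight α m := by
    intro m
    filter_upwards [ae_ne_flux false (1 - α) α
      (fun j => sgn j * (height α (j, 0) - vertexHeight α m))] with z hz hcon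
    apply hz
    have h2 : height α z = height α (z.1, 0) - sgn z.1 * z.2 := by simp [height]
    have h3 : height α (z.1, 0) - vertexHeight α m = sgn z.1 * z.2 := by linarith
    rw [h3, ← mul_assoc, sgn_mul_self, one_mul]
  rw [ae_all_iff]
  intro n
  rw [ae_all_iff]
  intro m
  exact (hT.iterate n).quasiMeasurePreserving.ae (key m)

/-- The first chord is longer than some `1 / (k + 1)`, and by conservativity almost every orbit
meets the chords longer than this infinitely often. So the durations cannot be summable. -/
theorem ae_tendsto_duration {α : ℝ} (h0 : 0 < α) (h1 : α < 1) (hα : Irrational α) :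
    ∀ᵐ z ∂flux false (1 - α) α, Tendsto
      (fun n => ∑ i ∈ Finset.range n, duration α ((chordStep α)^[i] z)) atTop atTop := by
  have hmaps := mapsTo_chordStep h0 h1
  have hrec : ∀ᵐ z ∂flux false (1 - α) α, ∀ k : ℕ, z ∈ {z | 1 / ((k : ℝ) + 1) < duration α z} →
      ∃ᶠ n in atTop, (chordStep α)^[n] z ∈ {z | 1 / ((k : ℝ) + 1) < duration α z} := by
    rw [ae_all_iff]
    intro k
    exact (conservative_chordStep h0 h1 hα).ae_mem_imp_frequently_image_mem
      (measurableSet_lt measurable_const (measurable_duration α)).nullMeasurableSet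
  filter_upwards [hrec, ae_height_ne h0 h1, ae_mem_strip false (1 - α) α] with z hz1 hz2 hz3
  have hpos : ∀ n, 0 < duration α ((chordStep α)^[n] z) := fun n =>
    duration_pos h0 h1 (hmaps.iterate n hz3) (hz2 n)
  rw [← not_summable_iff_tendsto_nat_atTop_of_nonneg fun n => (hpos n).le]
  intro hsum
  obtain ⟨k, hk⟩ := exists_nat_one_div_lt (hpos 0)
  have h2 := hz1 k hk
  have h3 := hsum.tendsto_atTop_zero.eventually_lt_const (u := 1 / ((k : ℝ) + 1)) (by positivity)
  obtain ⟨n, hn1, hn2⟩ := (h2.and_eventually h3).exists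
  exact absurd hn2 (not_lt.2 (le_of_lt hn1))

theorem exists_isRay_chord {α : ℝ} (h0 : 0 < α) (h1 : α < 1) {z : ℕ × ℝ}
    (hz : z ∈ strip false (1 - α) α)
    (hgood : ∀ n : ℕ, ∀ m, height α ((chordStep α)^[n] z) ≠ vertexHeight α m)
    (hdiv : Tendsto (fun n => ∑ i ∈ Finset.range n, duration α ((chordStep α)^[i] z)) atTop atTop) :
    ∃ γ, IsRay (1, α) γ ∧ ∀ n t, 0 ≤ t → t ≤ duration α ((chordStep α)^[n] z) →
      γ (∑ i ∈ Finset.range n, duration α ((chordStep α)^[i] z) + t) =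
        point (side ((chordStep α)^[n] z).1) (start α ((chordStep α)^[n] z) + t • (1, α)) := by
  have hs : ∀ n, (chordStep α)^[n] z ∈ strip false (1 - α) α := fun n =>
    (mapsTo_chordStep h0 h1).iterate n hz
  have hpos : ∀ n, 0 < duration α ((chordStep α)^[n] z) := fun n =>
    duration_pos h0 h1 (hs n) (hgood n)
  refine exists_isRay (fun n => side ((chordStep α)^[n] z).1) (fun n => start α ((chordStep α)^[n] z))
    (fun n => duration α ((chordStep α)^[n] z)) hpos hdiv
    (fun n t ht0 ht => chord_mem h0 h1 (hs n) ht0 ht)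
    (fun n t ht0 ht => point_chord_notMem_singularities h0 h1 (hs n) (hgood n) ht0 ht) fun n => ?_
  have h2 := hpos (n + 1)
  simp only [Function.iterate_succ_apply'] at h2 ⊢
  exact point_chord_end h0 h1 (hs n) (hpos n).le h2.le

/-- A set of points of the chords that is null along almost every chord is null in the plane. -/
theorem volume_image_chord_eq_zero {α : ℝ} {B : Set (ℝ × (ℕ × ℝ))}
    (hB : MeasurableSet B)
    (hB0 : ∀ t, flux false (1 - α) α {z | (t, z) ∈ B} = 0) :
    volume {p : ℝ × ℝ | ∃ z ∈ strip false (1 - α) α, ∃ t, (t, z) ∈ B ∧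
      p = start α z + t • ((1, α) : ℝ × ℝ)} = 0 := by
  let C : ℕ → Set (ℝ × ℝ) := fun j => {q | (q.1, (j, q.2)) ∈ B ∧ (j, q.2) ∈ strip false (1 - α) α}
  have hC : ∀ j, volume (C j) = 0 := by
    intro j
    have hm : MeasurableSet (C j) := by
      refine MeasurableSet.inter ?_ ?_
      · exact (measurable_fst.prodMk (measurable_const.prodMk measurable_snd)) hB
      · exact (measurable_const.prodMk measurable_snd) (measurableSet_strip false (1 - α) α)
    rw [Measure.volume_eq_prod, Measure.measure_prod_null hm]
    refine ae_of_all _ fun t => ?_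
    have h2 := hB0 t
    have hmt : MeasurableSet {z | (t, z) ∈ B} := measurable_prodMk_left hB
    rw [flux_apply _ _ _ hmt, ENNReal.tsum_eq_zero] at h2
    exact h2 j
  -- For each rectangle, time and transversal coordinate parametrize the points of its chords
  -- differentiably. Null sets of parameters therefore have null images, and no Jacobian is needed.
  let f : ℕ → ℝ × ℝ → ℝ × ℝ := fun j q => start α (j, q.2) + q.1 • ((1, α) : ℝ × ℝ)
  have hf : ∀ j, Differentiable ℝ (f j) := by
    intro j
    simp only [f, start, foot, height]
    fun_prop
  have hnull : volume (⋃ j, f j '' C j) = 0 := by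
    refine measure_iUnion_null fun j => ?_
    exact addHaar_image_eq_zero_of_differentiableOn_of_addHaar_eq_zero volume
      (hf j).differentiableOn (hC j)
  refine measure_mono_null ?_ hnull
  rintro p ⟨⟨j, c⟩, hz, t, ht, rfl⟩
  exact Set.mem_iUnion.2 ⟨j, (t, c), ⟨ht, hz⟩, rfl⟩

theorem isForwardRecurrent_one {α : ℝ} (h0 : 0 < α) (h1 : α < 1) (hα : Irrational α) :
    IsForwardRecurrent (1, α) := by
  intro A hA b
  have hM : ∀ b, ∃ M : Set (ℝ × ℝ), MeasurableSet M ∧ Subtype.val ⁻¹' M = proj b ⁻¹' A := fun b =>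
    measurable_proj b hA
  choose M hM hMA using hM
  -- `G` marks the pairs of an offset and a chord whose point at that offset is in `A`; `R`, the
  -- limit superior of its pullbacks, says that this happens infinitely often along the orbit at the
  -- same offset. Conservativity is applied to each slice of `G` at constant offset.
  let G : Set (ℝ × (ℕ × ℝ)) := {q | 0 ≤ q.1 ∧ q.1 ≤ duration α q.2 ∧
    start α q.2 + q.1 • ((1, α) : ℝ × ℝ) ∈ M (side q.2.1)}
  have hG : MeasurableSet G := by
    have hmap : Measurable fun q : ℝ × (ℕ × ℝ) => start α q.2 + q.1 • ((1, α) : ℝ × ℝ) :=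
      ((measurable_start α).comp measurable_snd).add (measurable_fst.smul_const _)
    have hside : Measurable fun q : ℝ × (ℕ × ℝ) => side q.2.1 :=
      (measurable_comp_fst side).comp measurable_snd
    have h3 : MeasurableSet {q : ℝ × (ℕ × ℝ) | start α q.2 + q.1 • ((1, α) : ℝ × ℝ) ∈
        M (side q.2.1)} := by
      have e : {q : ℝ × (ℕ × ℝ) | start α q.2 + q.1 • ((1, α) : ℝ × ℝ) ∈ M (side q.2.1)} =
          ⋃ b, ((fun q => side q.2.1) ⁻¹' {b} ∩
            (fun q => start α q.2 + q.1 • ((1, α) : ℝ × ℝ)) ⁻¹' M b) := by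
        ext q
        simp
      rw [e]
      exact MeasurableSet.iUnion fun b => (hside (measurableSet_singleton b)).inter (hmap (hM b))
    exact (measurableSet_le measurable_const measurable_fst).inter
      ((measurableSet_le measurable_fst ((measurable_duration α).comp measurable_snd)).inter h3)
  have hGt : ∀ t, MeasurableSet {z | (t, z) ∈ G} := fun t => measurable_prodMk_left hG
  let R : Set (ℝ × (ℕ × ℝ)) := ⋂ N : ℕ, ⋃ n : ℕ, ⋃ (_ : N ≤ n),
    {q | (q.1, (chordStep α)^[n] q.2) ∈ G}
  have hR : MeasurableSet R := by
    refine MeasurableSet.iInter fun N => MeasurableSet.iUnion fun n => MeasurableSet.iUnion fun _ => ?_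
    exact (measurable_fst.prodMk (((measurable_chordStep α).iterate n).comp measurable_snd)) hG
  have hRmem : ∀ t z, (t, z) ∈ R ↔ ∃ᶠ n in atTop, (t, (chordStep α)^[n] z) ∈ G := by
    intro t z
    simp only [R, Set.mem_iInter, Set.mem_iUnion, Set.mem_ofPred_eq, frequently_atTop, exists_prop]
  obtain ⟨N, hNsub, hN, hN0⟩ := exists_measurable_superset_of_null
    (ae_iff.1 ((ae_height_ne h0 h1).and (ae_tendsto_duration h0 h1 hα)))
  -- The bad pairs: those that fail to return, and chords whose orbit meets a vertex or has finite
  -- total duration.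
  let B : Set (ℝ × (ℕ × ℝ)) := (G \ R) ∪ {q | q.2 ∈ N}
  have hB : MeasurableSet B := (hG.diff hR).union (measurable_snd hN)
  have hB0 : ∀ t, flux false (1 - α) α {z | (t, z) ∈ B} = 0 := by
    intro t
    refine measure_mono_null (t := {z | (t, z) ∈ G \ R} ∪ N) (fun z hz => hz)
      (measure_union_null ?_ hN0)
    have h2 := (conservative_chordStep h0 h1 hα).ae_mem_imp_frequently_image_mem
      (hGt t).nullMeasurableSet
    rw [ae_iff] at h2
    refine measure_mono_null (fun z hz => ?_) h2
    intro hcon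
    exact hz.2 ((hRmem t z).2 (hcon hz.1))
  have hnull := volume_image_chord_eq_zero hB hB0
  have hline : ∀ᵐ p : ℝ × ℝ, ∀ m, (if b then (1 : ℝ) else -1) * (p.2 - α * p.1) ≠
      vertexHeight α m := by
    rw [ae_all_iff]
    intro m
    have h2 := volume_graph (fun x => α * x + (if b then (1 : ℝ) else -1) * vertexHeight α m)
      (by fun_prop)
    refine measure_mono_null (fun p hp => ?_) h2
    simp only [Set.mem_compl_iff, Set.mem_ofPred_eq, not_not] at hp ⊢
    rw [← hp, ← mul_assoc]
    cases b <;> simp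
  filter_upwards [measure_eq_zero_iff_ae_notMem.1 hnull, hline] with p hp1 hp2 hp hpA
  obtain ⟨z, hz, rfl, t, ht0, ht, rfl⟩ := exists_chord h0 h1 hp hp2
  have hzB : (t, z) ∉ B := fun h => hp1 ⟨z, hz, t, h, rfl⟩
  have hzN : z ∉ N := fun h => hzB (Or.inr h)
  have hgood := not_not.1 fun hcon => hzN (hNsub hcon)
  have hzG : (t, z) ∈ G := by
    refine ⟨ht0, ht, ?_⟩
    have : (⟨_, hp⟩ : polygon (side z.1)) ∈ proj (side z.1) ⁻¹' A := hpA
    rw [← hMA] at this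
    exact this
  have hfreq : ∃ᶠ n in atTop, (t, (chordStep α)^[n] z) ∈ G := by
    rw [← hRmem]
    by_contra hcon
    exact hzB (Or.inl ⟨hzG, hcon⟩)
  obtain ⟨γ, hγ, hγp⟩ := exists_isRay_chord h0 h1 hz hgood.1 hgood.2
  refine ⟨fun s => γ (t + s), hγ.shift ht0, ?_, ?_⟩
  · have := hγp 0 t ht0 ht
    simp only [Finset.range_zero, Finset.sum_empty, zero_add, Function.iterate_zero, id] at this
    change γ (t + 0) = _
    rw [add_zero, this, point_of_mem hp]
  · refine hgood.2.frequently (hfreq.mono fun n hn => ?_)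
    obtain ⟨-, hn2, hn3⟩ := hn
    simp only at hn2 hn3
    have hs := (mapsTo_chordStep h0 h1).iterate n hz
    have hm := chord_mem h0 h1 hs ht0 hn2
    change γ (t + _) ∈ A
    rw [add_comm t, hγp n t ht0 hn2, point_of_mem hm]
    have : (⟨_, hm⟩ : polygon (side ((chordStep α)^[n] z).1)) ∈
        proj (side ((chordStep α)^[n] z).1) ⁻¹' A := by
      rw [← hMA]
      exact hn3
    exact this

/-! ### Affine symmetries of the surface and reduction of the direction -/

/-- Affine involutions of the polygons that respect the edge identifications and the vertices carry
recurrence from one direction to another one. -/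
theorem IsForwardRecurrent.of_involution {v v' : ℝ × ℝ} (h : IsForwardRecurrent v')
    (β : Bool → Bool) (F : Bool → ℝ × ℝ → ℝ × ℝ) (hβ : ∀ b, β (β b) = b)
    (hF : ∀ b p, F (β b) (F b p) = p) (hmem : ∀ b, ∀ p ∈ polygon b, F b p ∈ polygon (β b))
    (hlin : ∀ b p (t : ℝ), F b (p + t • v') = F b p + t • v) (hdiff : ∀ b, Differentiable ℝ (F b))
    (hglue : ∀ n, ∀ p ∈ edge n, point (β true) (F true p) =
      point (β false) (F false (p - (vertex n + vertex (n + 1)))))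
    (hvert : ∀ b n, ∃ m, F b (if b then vertex n else -vertex n) =
      if β b then vertex m else -vertex m) :
    IsForwardRecurrent v := by
  let f : S₁ → S₁ := Quot.lift (fun x : Pieces => proj (β x.1) ⟨F x.1 x.2, hmem _ _ x.2.2⟩) (by
    rintro ⟨b, x⟩ ⟨b', y⟩ ⟨h1, h2, n, h3, h4⟩
    simp only at h1 h2 h3 h4
    subst h1 h2
    have h5 := hglue n x h3
    rw [← h4, point_of_mem (hmem _ _ x.2), point_of_mem (hmem _ _ y.2)] at h5
    exact h5)
  have hf : ∀ b p, f (proj b p) = proj (β b) ⟨F b p, hmem _ _ p.2⟩ := fun b p => rfl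
  have hff : ∀ x, f (f x) = x := by
    intro x
    induction x using Quot.ind with
    | mk x =>
      obtain ⟨b, p⟩ := x
      change f (f (proj b p)) = proj b p
      rw [hf, hf, ← point_of_mem, ← point_of_mem]
      simp only [hF, hβ]
  have hsing : ∀ x ∈ singularities, f x ∈ singularities := by
    rintro _ ⟨b, p, rfl, n, hn⟩
    obtain ⟨m, hm⟩ := hvert b n
    exact ⟨β b, _, hf b p, m, by simp only [hn]; exact hm⟩
  have hfm : Measurable f := by
    intro A hA
    refine MeasurableSpace.measurableSet_iInf.2 fun b => ?_
    have h1 : Measurable fun p : polygon b => (⟨F b p, hmem _ _ p.2⟩ : polygon (β b)) :=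
      (((hdiff b).continuous.measurable).comp measurable_subtype_coe).subtype_mk
    exact h1 (measurable_proj (β b) hA)
  -- The preimage of a null set under `F b` is its image under the differentiable inverse, hence
  -- null.
  have hae : ∀ (b : Bool) (Q : ℝ × ℝ → Prop), (∀ᵐ q, Q q) → ∀ᵐ p, Q (F b p) := by
    intro b Q hQ
    have h1 := addHaar_image_eq_zero_of_differentiableOn_of_addHaar_eq_zero volume
      (hdiff (β b)).differentiableOn (ae_iff.1 hQ)
    refine measure_mono_null ?_ h1
    exact fun p hp => ⟨F b p, hp, hF b p⟩
  intro A hA b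
  filter_upwards [hae b _ (h (f ⁻¹' A) (hfm hA) (β b))] with p hp hpb hpA
  obtain ⟨γ, hγ, hγ0, hγA⟩ := hp (hmem b p hpb) (by
    change f (f (proj b ⟨p, hpb⟩)) ∈ A
    rwa [hff])
  have hpiece : ∀ (b' : Bool) (q : ℝ × ℝ) (x : S₁) (s : ℝ),
      (∃ h : q + s • v' ∈ polygon b', x = proj b' ⟨q + s • v', h⟩) →
      ∃ h : F b' q + s • v ∈ polygon (β b'), f x = proj (β b') ⟨F b' q + s • v, h⟩ := by
    rintro b' q _ s ⟨h1, rfl⟩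
    have h2 := hmem b' _ h1
    rw [hlin] at h2
    refine ⟨h2, ?_⟩
    rw [hf]
    congr 2
    exact hlin b' q s
  refine ⟨fun t => f (γ t), fun t ht => ?_, ?_, hγA⟩
  · obtain ⟨h1, ⟨ε, hε, b', q, h2⟩, h3⟩ := hγ t ht
    refine ⟨fun h4 => h1 (hff (γ t) ▸ hsing _ h4),
      ⟨ε, hε, β b', F b' q, fun s hs => hpiece _ _ _ _ (h2 s hs)⟩, fun htpos => ?_⟩
    obtain ⟨ε', hε', b'', q', h4⟩ := h3 htpos
    exact ⟨ε', hε', β b'', F b'' q', fun s hs => hpiece _ _ _ _ (h4 s hs)⟩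
  · change f (γ 0) = _
    rw [hγ0]
    exact hff (proj b ⟨p, hpb⟩)

theorem point_edge {n : ℤ} {p : ℝ × ℝ} (hp : p ∈ edge n) :
    point true p = point false (p - (vertex n + vertex (n + 1))) := by
  have h1 : p ∈ polygon true := edge_subset_upperPolygon n hp
  have h2 : p - (vertex n + vertex (n + 1)) ∈ polygon false := by
    change -(p - (vertex n + vertex (n + 1))) ∈ upperPolygon
    rw [neg_sub]
    exact edge_subset_upperPolygon n (add_sub_mem_edge hp)
  rw [point_of_mem h1, point_of_mem h2]
  exact Quot.sound ⟨rfl, rfl, n, hp, rfl⟩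

/-- The rotation by `π` exchanges the two polygons. -/
theorem IsForwardRecurrent.neg {v : ℝ × ℝ} (h : IsForwardRecurrent v) : IsForwardRecurrent (-v) := by
  refine h.of_involution (fun b => !b) (fun _ p => -p) (by simp) (by simp) ?_ ?_ ?_ ?_ ?_
  · intro b p hp
    cases b
    · exact hp
    · change - -p ∈ upperPolygon
      rw [neg_neg]
      exact hp
  · intro b p t
    rw [neg_add, smul_neg]
  · intro b
    exact differentiable_id.neg
  · intro n p hp
    have h1 := point_edge (add_sub_mem_edge hp)
    change point false (-p) = point true (-(p - (vertex n + vertex (n + 1))))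
    rw [neg_sub, h1]
    congr 1
    abel
  · intro b n
    exact ⟨n, by cases b <;> simp⟩

/-- The affine reflection of the parabola that exchanges the vertices `n` and `m - n`. -/
def reflection (m : ℤ) (p : ℝ × ℝ) : ℝ × ℝ := (m - p.1, p.2 - 2 * m * p.1 + m ^ 2)

theorem reflection_vertex (m n : ℤ) : reflection m (vertex n) = vertex (m - n) := by
  ext <;> simp [reflection, vertex]; ring

theorem reflection_combination (m : ℤ) {a b : ℝ} (hab : a + b = 1) (p q : ℝ × ℝ) :
    reflection m (a • p + b • q) = a • reflection m p + b • reflection m q := by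
  have : a = 1 - b := by linarith
  subst this
  ext <;> simp [reflection] <;> ring

theorem reflection_reflection (m : ℤ) (p : ℝ × ℝ) : reflection m (reflection m p) = p := by
  ext <;> simp [reflection]; ring

theorem reflection_mem_upperPolygon (m : ℤ) {p : ℝ × ℝ} (hp : p ∈ upperPolygon) :
    reflection m p ∈ upperPolygon := by
  have hconv : Convex ℝ {p | reflection m p ∈ upperPolygon} := by
    intro p hp q hq a b ha hb hab
    change reflection m (a • p + b • q) ∈ upperPolygon
    rw [reflection_combination m hab]
    exact convex_convexHull ℝ _ hp hq ha hb hab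
  refine convexHull_min ?_ hconv hp
  rintro _ ⟨n, rfl⟩
  change reflection m (vertex n) ∈ upperPolygon
  rw [reflection_vertex]
  exact subset_convexHull ℝ _ ⟨_, rfl⟩

theorem reflection_mem_edge (m : ℤ) {n : ℤ} {p : ℝ × ℝ} (hp : p ∈ edge n) :
    reflection m p ∈ edge (m - n - 1) := by
  obtain ⟨a, b, ha, hb, hab, rfl⟩ := hp
  refine ⟨b, a, hb, ha, by rw [add_comm, hab], ?_⟩
  rw [reflection_combination m hab, reflection_vertex, reflection_vertex, add_comm]
  congr 3 <;> ring

/-- The reflection permutes the vertices of the upper polygon; conjugating it by the rotation gives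
the action on the lower one, and the two agree on glued edges. The new velocity is the image of `v`
under its linear part. -/
theorem IsForwardRecurrent.reflect {v : ℝ × ℝ} (h : IsForwardRecurrent v) (m : ℤ) :
    IsForwardRecurrent (-v.1, v.2 - 2 * m * v.1) := by
  have hd : Differentiable ℝ (reflection m) := by
    unfold reflection
    fun_prop
  refine h.of_involution id (fun b p => if b then reflection m p else -reflection m (-p))
    (fun _ => rfl) ?_ ?_ ?_ ?_ ?_ ?_
  · intro b p
    cases b <;> simp [reflection_reflection]
  · intro b p hp
    cases b
    · change - -reflection m (-p) ∈ upperPolygon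
      rw [neg_neg]
      exact reflection_mem_upperPolygon m hp
    · exact reflection_mem_upperPolygon m hp
  · intro b p t
    cases b <;> ext <;> simp [reflection] <;> ring
  · intro b
    cases b
    · exact (hd.comp differentiable_id.neg).neg
    · exact hd
  · intro n p hp
    have h1 := point_edge (reflection_mem_edge m hp)
    simp only [id, if_true, Bool.false_eq_true, if_false]
    rw [h1]
    congr 1
    ext
    · simp [reflection, vertex]; ring
    · simp [reflection, vertex]; ring
  · intro b n
    exact ⟨m - n, by cases b <;> simp [reflection_vertex]⟩

theorem IsForwardRecurrent.smul {v : ℝ × ℝ} (h : IsForwardRecurrent v) {a : ℝ} (ha : 0 < a) :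
    IsForwardRecurrent (a • v) := by
  intro A hA b
  filter_upwards [h A hA b] with p hp hpb hpA
  obtain ⟨γ, hγ, hγ0, hγA⟩ := hp hpb hpA
  refine ⟨fun t => γ (a * t), hγ.comp_mul ha, by simp only [mul_zero, hγ0], ?_⟩
  refine (tendsto_id.atTop_div_const ha).frequently (hγA.mono fun t ht => ?_)
  simp only [id]
  rwa [mul_div_cancel₀ _ ha.ne']

/-- The maps `a ↦ 2m - a` generate an infinite dihedral group with fundamental domain `[0, 1]`. If
the floor of `α` is even, two of them bring `α` into `(0, 1)`; if it is odd, one does. -/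
theorem isForwardRecurrent_slope {α : ℝ} (hα : Irrational α) : IsForwardRecurrent (1, α) := by
  have step : ∀ (m : ℤ) (a : ℝ), IsForwardRecurrent (1, a) → IsForwardRecurrent (1, 2 * m - a) := by
    intro m a h
    have := (h.reflect m).neg
    simpa using this
  have h1 := Int.floor_le α
  have h2 := Int.lt_floor_add_one α
  have h3 : (⌊α⌋ : ℝ) ≠ α := fun h => hα ⟨⌊α⌋, by simpa using h⟩
  have h4 := lt_of_le_of_ne h1 h3
  rcases Int.even_or_odd' ⌊α⌋ with ⟨k, hk | hk⟩ <;> rw [hk] at h2 h4 <;> push_cast at h2 h4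
  · have hirr : Irrational (α - 2 * k) := by
      have := hα.sub_intCast (2 * k)
      push_cast at this
      exact this
    have h5 := isForwardRecurrent_one (α := α - 2 * k) (by linarith) (by linarith) hirr
    have h6 := step k _ (step 0 _ h5)
    convert h6 using 2
    push_cast
    ring
  · have hirr : Irrational (2 * (k + 1) - α) := by
      have := hα.intCast_sub (2 * (k + 1))
      push_cast at this
      exact this
    have h5 := isForwardRecurrent_one (α := 2 * (k + 1) - α) (by linarith) (by linarith) hirr
    have h6 := step (k + 1) _ h5
    convert h6 using 2
    push_cast
    ring

theorem isForwardRecurrent {v : ℝ × ℝ} (hv : v.1 ≠ 0) (hslope : Irrational (v.2 / v.1)) :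
    IsForwardRecurrent v := by
  have h := isForwardRecurrent_slope hslope
  rcases lt_or_gt_of_ne hv with h1 | h1
  · have h2 := (h.smul (neg_pos.2 h1)).neg
    convert h2 using 1
    ext
    · simp
    · simp; field_simp
  · have h2 := h.smul h1
    convert h2 using 1
    ext
    · simp
    · simp; field_simp

end ParabolaSurface

/-- The directions `v` and `-v` are both forward recurrent, and the two opposite rays from a point
together form its trajectory. -/
theorem mainTheorem5 (v : ℝ × ℝ) (hv : v.1 ≠ 0) (hslope : Irrational (v.2 / v.1)) :
    ParabolaSurface.IsRecurrent v := by
  have h₁ := ParabolaSurface.isForwardRecurrent hv hslope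
  have h₂ := h₁.neg
  intro A hA
  refine ParabolaSurface.ae_area fun b => ?_
  filter_upwards [h₁ A hA b, h₂ A hA b] with p hp₁ hp₂ hpb hpA
  obtain ⟨γ₁, hγ₁, h01, hA₁⟩ := hp₁ hpb hpA
  obtain ⟨γ₂, hγ₂, h02, hA₂⟩ := hp₂ hpb hpA
  refine ⟨_, ParabolaSurface.isTrajectory_of_isRay hγ₁ hγ₂ (h01.trans h02.symm), ?_, ?_, ?_⟩
  · simpa using h01
  · refine (hA₁.and_eventually (eventually_ge_atTop 0)).mono fun t ht => ?_
    rw [if_pos ht.2]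
    exact ht.1
  · refine tendsto_neg_atTop_atBot.frequently
      ((hA₂.and_eventually (eventually_gt_atTop 0)).mono fun t ht => ?_)
    rw [if_neg (by linarith [ht.2]), neg_neg]
    exact ht.1
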